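/- Let $\Sigma$ be a first-order signature (function symbols of finite arity), $X$ a set of variables, and let $R$ be a weakly orthogonal infinitary term rewriting system over $\Sigma$: a set of rules $\ell\to r$, where $\ell$ is a finite term that is not a variable, $r$ is a finite or infinite term all of whose variables occur in $\ell$, every $\ell$ is left-linear (no variable occurs twice in it), and every critical pair $\langle s_1,s_2\rangle$ of $R$ is trivial, i.e. $s_1\equiv s_2$. (Collapsing rules are allowed.) A redex in a term $t$ is a pair $u=(p,\ell\to r)$ of a position $p$ of $t$ and a rule of $R$ such that the subterm of $t$ at $p$ is an instance of $\ell$; two redexes overlap if their patterns (the sets of positions in $t$ of the function symbols of their left-hand sides) intersect. For a set $U$ of pairwise non-overlapping redexes in $t$ (distinct members do not overlap), a development of $U$ is a strongly convergent rewrite sequence starting from $t$, of any ordinal length, in which only residuals of redexes in $U$ are contracted and at the end of which no residual of a redex in $U$ is left; its result is its last term. Developments of sets $U$ and $V$ of redexes in $t$ are called orthogonal to each other if, for all $u\in U$ and $v\in V$, whenever $u$ and $v$ overlap then $u=v$ (same position and same rule). Theorem. Let $t$ be a finite or infinite term over $\Sigma$ and $X$, and let $\sigma$ and $\delta$ be developments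 of sets $U$ and $V$ of redexes in $t$, respectively. Then there exists an orthogonalization of $\sigma$ and $\delta$: there are sets $U'$ and $V'$ of redexes in $t$, a development $\sigma'$ of $U'$ and a development $\delta'$ of $V'$, such that $\sigma'$ and $\delta'$ are orthogonal to each other, $\sigma'$ has the same result as $\sigma$, and $\delta'$ has the same result as $\delta$. -/

import Mathlib

universe u v w

namespace WOTRS

/-- A first-order signature: function symbols with finite arities. -/
structure Signature where
  Sym : Type u
  arity : Sym → ℕ

/-- Positions are finite sequences of argument indices (counted from 0), read from the root. -/
abbrev Pos := List ℕ

/-- A finite or infinite term over the signature `S` with variables from `V`: the partial labelling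
of positions by function symbols and variables. The root is labelled, and the labelled children of
a labelled position are exactly the arguments of its function symbol (variables have none). -/
@[ext]
structure ITerm (S : Signature.{u}) (V : Type v) where
  sym : Pos → Option (S.Sym ⊕ V)
  root : sym [] ≠ none
  child : ∀ (p : Pos) (i : ℕ),
    sym (p ++ [i]) ≠ none ↔ ∃ f, sym p = some (Sum.inl f) ∧ i < S.arity f

namespace ITerm

variable {S : Signature.{u}} {V : Type v} {W : Type w}

/-- A finite term is one with finitely many positions. -/
def IsFinite (t : ITerm S V) : Prop := {p : Pos | t.sym p ≠ none}.Finite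

/-- The term consisting of a single variable. -/
def var (x : V) : ITerm S V where
  sym p := if p = [] then some (Sum.inr x) else none
  root := by simp
  child p i := by
    by_cases hp : p = [] <;> simp [hp]

/-- The labelling of the term obtained by replacing each variable `x` by `θ x`. -/
def substSym (θ : V → ITerm S W) : (Pos → Option (S.Sym ⊕ V)) → Pos → Option (S.Sym ⊕ W)
  | s, [] =>
    match s [] with
    | some (Sum.inr x) => (θ x).sym []
    | some (Sum.inl f) => some (Sum.inl f)
    | none => none
  | s, i :: p =>
    match s [] with
    | some (Sum.inr x) => (θ x).sym (i :: p)
    | some (Sum.inl _) => substSym θ (fun q => s (i :: q)) p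
    | none => none

theorem substSym_nil_ne_none (θ : V → ITerm S W) (s : Pos → Option (S.Sym ⊕ V))
    (h : s [] ≠ none) : substSym θ s [] ≠ none := by
  rcases hs : s [] with _ | (f | x)
  · exact absurd hs h
  · simp [substSym, hs]
  · simpa [substSym, hs] using (θ x).root

theorem substSym_child (θ : V → ITerm S W) (p : Pos) (i : ℕ) :
    ∀ s : Pos → Option (S.Sym ⊕ V),
      (∀ (p : Pos) (i : ℕ),
        s (p ++ [i]) ≠ none ↔ ∃ f, s p = some (Sum.inl f) ∧ i < S.arity f) →
      (substSym θ s (p ++ [i]) ≠ none ↔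
        ∃ f, substSym θ s p = some (Sum.inl f) ∧ i < S.arity f) := by
  induction p with
  | nil =>
    intro s hs
    rcases h : s [] with _ | (f | x)
    · simp [substSym, h]
    · have h1 := hs [] i
      simp only [List.nil_append, h] at h1
      have h2 : substSym θ s ([] ++ [i]) = substSym θ (fun q => s (i :: q)) [] := by
        simp [substSym, h]
      have h3 : substSym θ s [] = some (Sum.inl f) := by simp [substSym, h]
      rw [h2, h3]
      constructor
      · intro h4
        obtain ⟨g, hg, hi⟩ := h1.1 fun h5 => h4 (by simp [substSym, h5])
        cases hg
        exact ⟨f, rfl, hi⟩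
      · rintro ⟨g, hg, hi⟩
        cases hg
        exact substSym_nil_ne_none θ _ (h1.2 ⟨f, rfl, hi⟩)
    · have := (θ x).child [] i
      simpa [substSym, h] using this
  | cons j p ih =>
    intro s hs
    rcases h : s [] with _ | (f | x)
    · simp [substSym, h]
    · have := ih (fun q => s (j :: q)) (fun q k => hs (j :: q) k)
      simpa [substSym, h] using this
    · have := (θ x).child (j :: p) i
      simpa [substSym, h] using this

/-- Simultaneous substitution of terms for variables. -/
def subst (θ : V → ITerm S W) (t : ITerm S V) : ITerm S W where
  sym := substSym θ t.sym
  root := substSym_nil_ne_none θ _ t.root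
  child p i := substSym_child θ p i _ t.child

/-- Renaming of variables. -/
def rename (g : V → W) (t : ITerm S V) : ITerm S W := t.subst fun x => var (g x)

/-- `u` is the subterm of `t` at position `p` (in particular `p` is a position of `t`). -/
def IsSubtermAt (t : ITerm S V) (p : Pos) (u : ITerm S V) : Prop :=
  ∀ q, t.sym (p ++ q) = u.sym q

/-- `t'` is the term `t[u]_p` obtained from `t` by replacing the subterm at position `p` by `u`. -/
def IsReplaceAt (t : ITerm S V) (p : Pos) (u t' : ITerm S V) : Prop :=
  t.sym p ≠ none ∧ t'.IsSubtermAt p u ∧ ∀ q, ¬ p <+: q → t'.sym q = t.sym q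

/-- `θ` is a most general unifier of `t` and `u` among substitutions of finite terms. -/
def IsMGU (θ : V → ITerm S V) (t u : ITerm S V) : Prop :=
  (∀ x, (θ x).IsFinite) ∧ t.subst θ = u.subst θ ∧
    ∀ θ' : V → ITerm S V, (∀ x, (θ' x).IsFinite) → t.subst θ' = u.subst θ' →
      ∃ η : V → ITerm S V, (∀ x, (η x).IsFinite) ∧ ∀ x, θ' x = (θ x).subst η

end ITerm

/-- An infinitary rewrite rule: the left-hand side is a finite term that is not a variable, the
right-hand side is a possibly infinite term whose variables occur in the left-hand side. -/
@[ext]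
structure Rule (S : Signature.{u}) (V : Type v) where
  lhs : ITerm S V
  rhs : ITerm S V
  lhs_finite : lhs.IsFinite
  lhs_not_var : ∃ f, lhs.sym [] = some (Sum.inl f)
  rhs_vars : ∀ x q, rhs.sym q = some (Sum.inr x) → ∃ p, lhs.sym p = some (Sum.inr x)

section Systems

variable {S : Signature.{u}} {V : Type v}

/-- No variable has more than one occurrence in the left-hand side. -/
def Rule.LeftLinear (ρ : Rule S V) : Prop :=
  ∀ x p q, ρ.lhs.sym p = some (Sum.inr x) → ρ.lhs.sym q = some (Sum.inr x) → p = q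

/-- `(s₁, s₂)` is a critical pair of the rule set `R`: the left-hand side of `ρ₂` is unified with
the subterm of the left-hand side of `ρ₁` at a non-variable position `p`, and `s₁`, `s₂` arise by
contracting the `ρ₁`-redex and the `ρ₂`-redex. The two rules are renamed apart through
`Sum.inl` and `Sum.inr`; the overlap of a rule with itself at the root is not counted. -/
def IsCriticalPair (R : Set (Rule S V)) (s₁ s₂ : ITerm S (V ⊕ V)) : Prop :=
  ∃ ρ₁ ∈ R, ∃ ρ₂ ∈ R, ∃ (p : Pos) (f : S.Sym) (l : ITerm S (V ⊕ V)) (θ : V ⊕ V → ITerm S (V ⊕ V)),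
    ρ₁.lhs.sym p = some (Sum.inl f) ∧
    ¬ (p = [] ∧ ρ₁ = ρ₂) ∧
    (ρ₁.lhs.rename Sum.inl).IsSubtermAt p l ∧
    ITerm.IsMGU θ l (ρ₂.lhs.rename Sum.inr) ∧
    s₁ = (ρ₁.rhs.rename Sum.inl).subst θ ∧
    ((ρ₁.lhs.rename Sum.inl).subst θ).IsReplaceAt p ((ρ₂.rhs.rename Sum.inr).subst θ) s₂

/-- All rules are left-linear and all critical pairs are trivial. -/
def WeaklyOrthogonal (R : Set (Rule S V)) : Prop :=
  (∀ ρ ∈ R, ρ.LeftLinear) ∧ ∀ s₁ s₂, IsCriticalPair R s₁ s₂ → s₁ = s₂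

end Systems

/-- A (candidate) redex occurrence: a position together with a rule. -/
@[ext]
structure Redex (S : Signature.{u}) (V : Type v) where
  pos : Pos
  rule : Rule S V

namespace Redex

variable {S : Signature.{u}} {V : Type v}

/-- `u` is a redex of the system `R` in the term `t`. -/
def In (R : Set (Rule S V)) (t : ITerm S V) (u : Redex S V) : Prop :=
  u.rule ∈ R ∧ ∃ θ : V → ITerm S V, t.IsSubtermAt u.pos (u.rule.lhs.subst θ)

/-- The rewrite step `t → t'` that contracts the redex `u`. -/
def Contracts (t : ITerm S V) (u : Redex S V) (t' : ITerm S V) : Prop :=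
  ∃ θ : V → ITerm S V, t.IsSubtermAt u.pos (u.rule.lhs.subst θ) ∧
    t.IsReplaceAt u.pos (u.rule.rhs.subst θ) t'

/-- The pattern of a redex: the positions of the function symbols of its left-hand side. -/
def pattern (u : Redex S V) : Set Pos :=
  {p | ∃ q f, u.rule.lhs.sym q = some (Sum.inl f) ∧ p = u.pos ++ q}

/-- Two redexes overlap if their patterns share a symbol occurrence. A redex overlaps itself. -/
def Overlap (u v : Redex S V) : Prop := (u.pattern ∩ v.pattern).Nonempty

/-- `w'` is a residual of `w` after the contraction of `u`, for redexes `u`, `w` that are equal or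
do not overlap. A redex that is not at or below `u` stays where it is; a redex inside the subterm
matched by a variable `x` of the left-hand side is copied to every occurrence of `x` in the
right-hand side; `u` itself has no residual. -/
def IsResidual (u w w' : Redex S V) : Prop :=
  w'.rule = w.rule ∧
    ((¬ u.pos <+: w.pos ∧ w'.pos = w.pos) ∨
      ∃ x o o' q, u.rule.lhs.sym o = some (Sum.inr x) ∧ u.rule.rhs.sym o' = some (Sum.inr x) ∧
        w.pos = u.pos ++ o ++ q ∧ w'.pos = u.pos ++ o' ++ q)

end Redex

/-- A (complete) development in the system `R` of a set `U` of pairwise non-overlapping redexes in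
`t`: a strongly convergent rewrite sequence from `t`, of arbitrary ordinal length, that contracts
only residuals of redexes in `U` and leaves none. `term β` is the `β`-th term of the sequence,
`left β` is the set of residuals of `U` in it, and `step β` is the redex contracted in it; values
beyond the length are irrelevant. Strongly convergent sequences have countable length, so ordinals
from the lowest universe suffice. -/
structure Development {S : Signature.{u}} {V : Type v} (R : Set (Rule S V)) (t : ITerm S V)
    (U : Set (Redex S V)) where
  isRedex : ∀ u ∈ U, u.In R t
  nonOverlapping : ∀ u ∈ U, ∀ v ∈ U, u.Overlap v → u = v
  length : Ordinal.{0}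
  term : Ordinal.{0} → ITerm S V
  left : Ordinal.{0} → Set (Redex S V)
  step : Ordinal.{0} → Redex S V
  term_zero : term 0 = t
  left_zero : left 0 = U
  step_mem : ∀ β < length, step β ∈ left β
  contracts : ∀ β < length, (step β).Contracts (term β) (term (Order.succ β))
  left_succ : ∀ β < length,
    left (Order.succ β) = {w' | ∃ w ∈ left β, (step β).IsResidual w w'}
  /-- Below a limit ordinal the depth of the contracted redexes tends to infinity. -/
  strong : ∀ l ≤ length, Order.IsSuccLimit l →
    ∀ d : ℕ, ∃ β < l, ∀ γ, β ≤ γ → γ < l → d < (step γ).pos.length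
  /-- At a limit ordinal the terms converge, in the usual metric, to the term there. -/
  term_limit : ∀ l ≤ length, Order.IsSuccLimit l →
    ∀ d : ℕ, ∃ β < l, ∀ γ, β ≤ γ → γ < l →
      ∀ p : Pos, p.length ≤ d → (term γ).sym p = (term l).sym p
  /-- The residuals at a limit ordinal are those that are eventually present below it. -/
  left_limit : ∀ l ≤ length, Order.IsSuccLimit l →
    ∀ w, w ∈ left l ↔ ∃ β < l, ∀ γ, β ≤ γ → γ < l → w ∈ left γ
  complete : left length = ∅

namespace Development

variable {S : Signature.{u}} {V : Type v} {R : Set (Rule S V)} {t : ITerm S V}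
  {U U' : Set (Redex S V)}

/-- The result of a development. -/
def target (σ : Development R t U) : ITerm S V := σ.term σ.length

/-- Two developments from the same term are orthogonal if overlapping redexes of the two developed
sets are the same, that is, have the same position and the same rule. -/
def Orthogonal (_σ : Development R t U) (_δ : Development R t U') : Prop :=
  ∀ u ∈ U, ∀ v ∈ U', u.Overlap v → u = v

end Development

/-- An orthogonalization of `σ` and `δ`: a pair of orthogonal developments of redexes in the same
term with the same results as `σ` and `δ`, respectively. -/
def IsOrthogonalization {S : Signature.{u}} {V : Type v} {R : Set (Rule S V)} {t : ITerm S V}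
    {U₁ V₁ U₂ V₂ : Set (Redex S V)} (σ : Development R t U₁) (δ : Development R t V₁)
    (σ' : Development R t U₂) (δ' : Development R t V₂) : Prop :=
  σ'.Orthogonal δ' ∧ σ'.target = σ.target ∧ δ'.target = δ.target

end WOTRS

/-!
The proof replaces developments by a description of their results. `Eval t U p q a` says that
following one path through `t`, in which each redex of `U` is read as its right-hand side, produces
the label `a` at position `q` of the result of developing `U` below `p`. As an inductive predicate
it excludes infinite towers of collapsing redexes, so that `Dev t U s` ("evaluation produces all
labels of `s`") expresses that `U` has a development with result `s`:

* `Development.dev_target`: the labels of the result of a development are evaluated. A contraction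
  step reflects evaluations (`Eval.of_residuals`), and at a limit ordinal a finite derivation exists
  already below the limit (`Development.eval_below_limit`).
* `exists_development`: conversely, repeatedly contracting the redex whose position has the least
  code under an encoding of positions by natural numbers is a development of length at most `ω`.
  Strong convergence holds because an evaluation meets only finitely many consecutive collapsing
  redexes at each position (`Run.cleared_succ`).

It remains to change `U` and `V` into sets that are orthogonal to each other without losing
evaluations (`exists_orthogonal`). Let `K` be a connected component of `U ∪ V` under overlap, and cut
`t` down to the positions covered by the patterns of `K`, turning each subterm that is cut off into
a variable named by its position. Evaluations in `t` decompose into evaluations in these truncated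
terms, so it suffices to treat each component in its truncated term (`Eval.exchange`). There, by weak
orthogonality, contracting any member of `K` yields the same term `N` (`Contr.eq_of_overlap`; critical
pairs lift to overlaps in infinite terms because left-linear rules have an explicit most general
unifier, `linearUnifier`). If `N` is the truncated term itself, then developing any redexes of `K`
changes nothing, and they are all dropped. Otherwise `N` differs from the truncated term at some
position `p`; a contraction changes a term only below the redex, so all members of `K` lie on the path
to `p`. Then there are finitely many of them, and the conflicts between `U` and `V` are removed one by
one, from the top: a redex that overlaps only one redex of the other set replaces it
(`Eval.replace`, `exists_replaceable`, `exists_orthogonal_of_path`).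

Dropping trivial components deals with infinite chains of overlapping redexes as well: contracting
a redex far down the chain leaves a given position unchanged, so the common contraction is trivial.
-/

namespace WOTRS

/-! ### Terms and positions -/

namespace ITerm

variable {S : Signature.{u}} {V : Type v} {W : Type w}

theorem sym_ne_none_of_append {t : ITerm S V} {p : Pos} :
    ∀ {q : Pos}, t.sym (p ++ q) ≠ none → t.sym p ≠ none := by
  intro q
  induction q using List.reverseRecOn with
  | nil => simp
  | append_singleton q i ih =>
    intro h
    rw [← List.append_assoc] at h
    obtain ⟨f, hf, -⟩ := (t.child _ i).1 h
    exact ih (by simp [hf])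

theorem exists_fun_of_append {t : ITerm S V} {p q : Pos} (h : t.sym (p ++ q) ≠ none)
    (hq : q ≠ []) : ∃ f, t.sym p = some (Sum.inl f) := by
  obtain ⟨i, q, rfl⟩ := List.exists_cons_of_ne_nil hq
  have h1 : t.sym ((p ++ [i]) ++ q) ≠ none := by simpa using h
  obtain ⟨f, hf, -⟩ := (t.child _ i).1 (sym_ne_none_of_append h1)
  exact ⟨f, hf⟩

theorem eq_nil_of_var_append {t : ITerm S V} {p q : Pos} {x : V} (hx : t.sym p = some (Sum.inr x))
    (h : t.sym (p ++ q) ≠ none) : q = [] := by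
  by_contra hq
  obtain ⟨f, hf⟩ := exists_fun_of_append h hq
  simp [hx] at hf

theorem fun_of_fun_append {t : ITerm S V} {p q : Pos} {f : S.Sym}
    (h : t.sym (p ++ q) = some (Sum.inl f)) : ∃ g, t.sym p = some (Sum.inl g) := by
  by_cases hq : q = []
  · subst hq
    exact ⟨f, by simpa using h⟩
  · exact exists_fun_of_append (by simp [h]) hq

theorem child_ne_none {t : ITerm S V} {p : Pos} {i : ℕ} {f : S.Sym}
    (hf : t.sym p = some (Sum.inl f)) (hi : i < S.arity f) : t.sym (p ++ [i]) ≠ none :=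
  (t.child p i).2 ⟨f, hf, hi⟩

theorem lt_arity {t : ITerm S V} {p : Pos} {i : ℕ} {f : S.Sym}
    (hf : t.sym p = some (Sum.inl f)) (h : t.sym (p ++ [i]) ≠ none) : i < S.arity f := by
  obtain ⟨g, hg, hi⟩ := (t.child p i).1 h
  rw [hf] at hg
  cases hg
  exact hi

/-- A position lying below two variable occurrences lies below the same one. -/
theorem var_append_inj {t : ITerm S V} {o o' q q' : Pos} {x x' : V}
    (ho : t.sym o = some (Sum.inr x)) (ho' : t.sym o' = some (Sum.inr x'))
    (h : o ++ q = o' ++ q') : o = o' ∧ q = q' ∧ x = x' := by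
  rcases List.append_eq_append_iff.1 h with ⟨a, h1, h2⟩ | ⟨a, h1, h2⟩
  · have := eq_nil_of_var_append ho (q := a) (by rw [← h1]; simp [ho'])
    subst this
    simp at h1 h2
    subst h1 h2
    rw [ho] at ho'
    cases ho'
    simp
  · have := eq_nil_of_var_append ho' (q := a) (by rw [← h1]; simp [ho])
    subst this
    simp at h1 h2
    subst h1 h2
    rw [ho] at ho'
    cases ho'
    simp

theorem fun_ne_var_append {t : ITerm S V} {m o q : Pos} {f : S.Sym} {x : V}
    (hm : t.sym m = some (Sum.inl f)) (ho : t.sym o = some (Sum.inr x)) : m ≠ o ++ q := by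
  rintro rfl
  obtain ⟨g, hg⟩ := fun_of_fun_append hm
  simp [ho] at hg

/-- A term cannot be extended: if all labels of `s` occur in `s'`, then `s` and `s'` are equal. -/
theorem eq_of_le {s s' : ITerm S V} (h : ∀ q a, s.sym q = some a → s'.sym q = some a) :
    s = s' := by
  ext1
  funext q
  rcases hq : s.sym q with _ | a
  · symm
    induction q using List.reverseRecOn with
    | nil => exact absurd hq s.root
    | append_singleton q i ih =>
      by_contra hn
      obtain ⟨f, hf, hi⟩ := (s'.child q i).1 hn
      rcases hs : s.sym q with _ | a
      · simp [ih hs] at hf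
      · have := h _ _ hs
        rw [hf] at this
        cases this
        exact child_ne_none hs hi hq
  · exact (h _ _ hq).symm

/-- If the function symbols of `r` reappear in `N` below `p`, then each position of `N` below `p`
is a function position of `r` or lies below a variable of `r`. -/
theorem fun_or_below_var (r : ITerm S V) (N : ITerm S W) (p : Pos)
    (h : ∀ m f, r.sym m = some (Sum.inl f) → N.sym (p ++ m) = some (Sum.inl f)) :
    ∀ m, N.sym (p ++ m) ≠ none → (∃ f, r.sym m = some (Sum.inl f)) ∨
      ∃ o q x, m = o ++ q ∧ r.sym o = some (Sum.inr x) := by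
  have key : ∀ m, r.sym m ≠ none → (∃ f, r.sym m = some (Sum.inl f)) ∨
      ∃ o q x, m = o ++ q ∧ r.sym o = some (Sum.inr x) := by
    intro m hm
    rcases hr : r.sym m with _ | (f | x)
    · exact absurd hr hm
    · exact Or.inl ⟨f, rfl⟩
    · exact Or.inr ⟨m, [], x, by simp, hr⟩
  intro m
  induction m using List.reverseRecOn with
  | nil => exact fun _ => key [] r.root
  | append_singleton m i ih =>
    intro hn
    rw [← List.append_assoc] at hn
    rcases ih (sym_ne_none_of_append hn) with ⟨f, hf⟩ | ⟨o, q, x, rfl, hx⟩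
    · exact key _ (child_ne_none hf (lt_arity (h _ _ hf) hn))
    · exact Or.inr ⟨o, q ++ [i], x, by simp, hx⟩

/-- The subterm at a position. -/
def subtermAt (t : ITerm S V) (p : Pos) (h : t.sym p ≠ none) : ITerm S V where
  sym q := t.sym (p ++ q)
  root := by simpa using h
  child q i := by rw [← List.append_assoc]; exact t.child _ i

theorem subst_fun {t : ITerm S V} {θ : V → ITerm S W} {f : S.Sym} :
    ∀ {q : Pos}, t.sym q = some (Sum.inl f) → (t.subst θ).sym q = some (Sum.inl f) := by
  intro q
  show t.sym q = _ → substSym θ t.sym q = _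
  induction q generalizing t with
  | nil => intro h; simp [substSym, h]
  | cons i q ih =>
    intro h
    obtain ⟨g, hg⟩ := exists_fun_of_append (t := t) (p := []) (q := i :: q) (by simp [h]) (by simp)
    have hi : t.sym [i] ≠ none :=
      sym_ne_none_of_append (p := [i]) (q := q) (by simp [h])
    have := ih (t := t.subtermAt [i] hi) h
    simpa [substSym, hg, subtermAt] using this

theorem subst_var {t : ITerm S V} {θ : V → ITerm S W} {x : V} (r : Pos) :
    ∀ {o : Pos}, t.sym o = some (Sum.inr x) → (t.subst θ).sym (o ++ r) = (θ x).sym r := by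
  intro o
  show t.sym o = _ → substSym θ t.sym (o ++ r) = _
  induction o generalizing t with
  | nil =>
    intro h
    cases r <;> simp [substSym, h]
  | cons i q ih =>
    intro h
    obtain ⟨g, hg⟩ := exists_fun_of_append (t := t) (p := []) (q := i :: q) (by simp [h]) (by simp)
    have hi : t.sym [i] ≠ none :=
      sym_ne_none_of_append (p := [i]) (q := q) (by simp [h])
    have := ih (t := t.subtermAt [i] hi) h
    simpa [substSym, hg, subtermAt] using this

theorem subst_var' {t : ITerm S V} {θ : V → ITerm S W} {x : V} {o : Pos}
    (h : t.sym o = some (Sum.inr x)) : (t.subst θ).sym o = (θ x).sym [] := by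
  simpa using subst_var (θ := θ) [] h

theorem subst_cases {t : ITerm S V} {θ : V → ITerm S W} {q : Pos}
    (h : (t.subst θ).sym q ≠ none) : (∃ f, t.sym q = some (Sum.inl f)) ∨
      ∃ o r x, q = o ++ r ∧ t.sym o = some (Sum.inr x) :=
  fun_or_below_var t (t.subst θ) [] (fun _ _ hm => subst_fun hm) q h

/-- To identify a substitution instance it suffices to check the function symbols of the term and
the labels of the substituted terms; the positions of `N` are then exhausted. -/
theorem subst_eq_of {t : ITerm S V} {θ : V → ITerm S W} {N : ITerm S W}
    (hf : ∀ q f, t.sym q = some (Sum.inl f) → N.sym q = some (Sum.inl f))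
    (hv : ∀ o x r a, t.sym o = some (Sum.inr x) → (θ x).sym r = some a →
      N.sym (o ++ r) = some a) : t.subst θ = N := by
  apply eq_of_le
  intro q a ha
  rcases subst_cases (by rw [ha]; simp) with ⟨f, h⟩ | ⟨o, r, x, rfl, h⟩
  · rw [subst_fun h] at ha
    rw [hf q f h, ← ha]
  · rw [subst_var r h] at ha
    exact hv _ _ _ _ h ha

theorem var_sym_nil (x : V) : (var x : ITerm S V).sym [] = some (Sum.inr x) := rfl

theorem rename_fun {g : V → W} {t : ITerm S V} {q : Pos} {f : S.Sym} :
    (t.rename g).sym q = some (Sum.inl f) ↔ t.sym q = some (Sum.inl f) := by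
  refine ⟨fun h => ?_, fun h => subst_fun h⟩
  rcases subst_cases (t := t) (θ := fun x => var (g x)) (q := q)
    (by show (t.rename g).sym q ≠ none; rw [h]; simp) with ⟨f', h'⟩ | ⟨o, r, x, rfl, h'⟩
  · have := subst_fun (θ := fun x => (var (g x) : ITerm S W)) h'
    change (t.rename g).sym q = _ at this
    rw [h] at this
    cases this
    exact h'
  · have := subst_var (θ := fun x => (var (g x) : ITerm S W)) r h'
    change (t.rename g).sym _ = _ at this
    rw [h] at this
    cases r <;> simp [var] at this

theorem rename_var_of {g : V → W} {t : ITerm S V} {q : Pos} {x : V}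
    (h : t.sym q = some (Sum.inr x)) : (t.rename g).sym q = some (Sum.inr (g x)) :=
  subst_var' h

theorem rename_var {g : V → W} {t : ITerm S V} {q : Pos} {y : W}
    (h : (t.rename g).sym q = some (Sum.inr y)) :
    ∃ x, t.sym q = some (Sum.inr x) ∧ y = g x := by
  rcases subst_cases (t := t) (θ := fun x => var (g x)) (q := q)
    (by show (t.rename g).sym q ≠ none; rw [h]; simp) with ⟨f', h'⟩ | ⟨o, r, x, rfl, h'⟩
  · have := rename_fun (g := g) |>.2 h'
    rw [h] at this
    cases this
  · have := subst_var (θ := fun x => (var (g x) : ITerm S W)) r h'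
    change (t.rename g).sym _ = _ at this
    rw [h] at this
    cases r with
    | nil =>
      simp [var] at this
      exact ⟨x, by simpa using h', this⟩
    | cons i r => simp [var] at this

theorem rename_ne_none {g : V → W} {t : ITerm S V} {q : Pos} :
    (t.rename g).sym q ≠ none ↔ t.sym q ≠ none := by
  constructor
  · intro h
    rcases hq : (t.rename g).sym q with _ | (f | y)
    · exact absurd hq h
    · rw [rename_fun.1 hq]; simp
    · obtain ⟨x, hx, -⟩ := rename_var hq
      rw [hx]; simp
  · intro h
    rcases hq : t.sym q with _ | (f | y)
    · exact absurd hq h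
    · rw [rename_fun.2 hq]; simp
    · rw [rename_var_of hq]; simp

theorem subst_var_self (x : V) (θ : V → ITerm S W) : (var x : ITerm S V).subst θ = θ x :=
  (eq_of_le fun q a h => by
    rw [← h]
    exact subst_var (θ := θ) q (o := []) (var_sym_nil x)).symm

/-- Substitution commutes with taking subterms. -/
theorem subst_subtermAt {t : ITerm S V} {p : Pos} (h : t.sym p ≠ none) (θ : V → ITerm S W)
    (q : Pos) : ((t.subtermAt p h).subst θ).sym q = (t.subst θ).sym (p ++ q) := by
  have h0 : (t.subst θ).sym p ≠ none := by
    rcases hq : t.sym p with _ | (f | y)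
    · exact absurd hq h
    · rw [subst_fun hq]; simp
    · rw [subst_var' hq]; exact (θ y).root
  have : (t.subtermAt p h).subst θ = (t.subst θ).subtermAt p h0 := by
    apply subst_eq_of
    · intro q f hq
      exact subst_fun (t := t) (q := p ++ q) hq
    · intro o x r a ho hr
      rw [← hr]
      have := subst_var (θ := θ) r (t := t) (o := p ++ o) ho
      rw [← this, List.append_assoc]
      rfl
  rw [this]
  rfl

theorem subst_subst {Z : Type*} (t : ITerm S V) (θ : V → ITerm S W) (η : W → ITerm S Z) :
    t.subst (fun x => (θ x).subst η) = (t.subst θ).subst η := by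
  apply subst_eq_of
  · intro q f h
    exact subst_fun (subst_fun h)
  · intro o x r a ho hr
    rw [← hr]
    have h0 : (t.subst θ).sym o ≠ none := by rw [subst_var' ho]; exact (θ x).root
    rw [← subst_subtermAt h0 η r]
    congr 2
    exact (eq_of_le fun q b hb => by rw [← hb]; exact subst_var q ho).symm

theorem rename_subst {Z : Type*} (g : V → W) (t : ITerm S V) (η : W → ITerm S Z) :
    (t.rename g).subst η = t.subst fun x => η (g x) := by
  rw [rename, ← subst_subst]
  congr 1
  funext x
  exact subst_var_self _ _

/-- The term `t[r]_p`. -/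
def replaceAt (t : ITerm S V) (p : Pos) (r : ITerm S V) (h : t.sym p ≠ none) : ITerm S V where
  sym q := open Classical in if p <+: q then r.sym (q.drop p.length) else t.sym q
  root := by
    by_cases hp : p = []
    · simpa [hp] using r.root
    · simpa [hp] using t.root
  child q i := by
    by_cases hp : p <+: q
    · obtain ⟨m, rfl⟩ := hp
      have h1 : p <+: p ++ m ++ [i] := by simp
      have h2 : p <+: p ++ m := by simp
      rw [if_pos h1, if_pos h2]
      simpa using r.child m i
    · by_cases hp' : p <+: q ++ [i]
      · have : p = q ++ [i] := by
          rcases List.prefix_concat_iff.1 hp' with h1 | h1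
          · exact h1
          · exact absurd h1 hp
        subst this
        rw [if_pos hp', if_neg hp]
        have := t.child q i
        simp only [List.drop_length, ne_eq, r.root, not_false_eq_true, true_iff]
        exact this.1 h
      · rw [if_neg hp, if_neg hp']
        exact t.child q i

theorem isReplaceAt_replaceAt (t : ITerm S V) (p : Pos) (r : ITerm S V) (h : t.sym p ≠ none) :
    t.IsReplaceAt p r (t.replaceAt p r h) := by
  refine ⟨h, fun q => ?_, fun q hq => ?_⟩
  · simp [replaceAt]
  · simp [replaceAt, hq]

end ITerm

/-! ### Matching and contraction, symbol by symbol -/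

open ITerm

variable {S : Signature.{u}} {V : Type v} {W : Type w}

/-- The function symbols of the left-hand side of `u` occur in `s` at the position of `u`. For a
left-linear rule this says that `u` is a redex in `s`. The variables of `s` need not be those of
the rules. -/
def Redex.Matches (s : ITerm S W) (u : Redex S V) : Prop :=
  ∀ q f, u.rule.lhs.sym q = some (Sum.inl f) → s.sym (u.pos ++ q) = some (Sum.inl f)

/-- `N` arises from `s` by contracting `u`, expressed through the labels of `N`. -/
structure Contr (s : ITerm S W) (u : Redex S V) (N : ITerm S W) : Prop where
  outside : ∀ q, ¬ u.pos <+: q → N.sym q = s.sym q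
  fn : ∀ q f, u.rule.rhs.sym q = some (Sum.inl f) → N.sym (u.pos ++ q) = some (Sum.inl f)
  arg : ∀ x o o' r, u.rule.lhs.sym o = some (Sum.inr x) → u.rule.rhs.sym o' = some (Sum.inr x) →
    N.sym (u.pos ++ (o' ++ r)) = s.sym (u.pos ++ (o ++ r))

/-- Contraction determines its result: the positions that the clauses of `Contr` do not mention
are not positions of the result. -/
theorem Contr.unique {s : ITerm S W} {u : Redex S V} {N N' : ITerm S W} (h : Contr s u N)
    (h' : Contr s u N') : N = N' := by
  apply eq_of_le
  intro q a ha
  by_cases hq : u.pos <+: q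
  · obtain ⟨m, rfl⟩ := hq
    rcases fun_or_below_var u.rule.rhs N u.pos h.fn m (by simp [ha]) with
      ⟨f, hf⟩ | ⟨o', r, x, rfl, hx⟩
    · rw [h'.fn _ _ hf, ← ha, h.fn _ _ hf]
    · obtain ⟨o, ho⟩ := u.rule.rhs_vars _ _ hx
      rw [h'.arg _ _ _ _ ho hx, ← ha, h.arg _ _ _ _ ho hx]
  · rw [h'.outside _ hq, ← ha, h.outside _ hq]

theorem matches_of_isSubtermAt {s : ITerm S W} {u : Redex S V} {θ : V → ITerm S W}
    (h : s.IsSubtermAt u.pos (u.rule.lhs.subst θ)) : u.Matches s := by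
  intro q f hf
  rw [h q, subst_fun hf]

theorem contr_of_isReplaceAt {s N : ITerm S W} {u : Redex S V} {θ : V → ITerm S W}
    (h : s.IsSubtermAt u.pos (u.rule.lhs.subst θ))
    (hN : s.IsReplaceAt u.pos (u.rule.rhs.subst θ) N) : Contr s u N where
  outside := hN.2.2
  fn q f hf := by rw [hN.2.1 q, subst_fun hf]
  arg x o o' r ho ho' := by rw [hN.2.1, h, subst_var _ ho, subst_var _ ho']

theorem Redex.Contracts.contr {t t' : ITerm S V} {u : Redex S V} (h : u.Contracts t t') :
    Contr t u t' := by
  obtain ⟨θ, h1, h2⟩ := h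
  exact contr_of_isReplaceAt h1 h2

theorem Redex.Matches.ne_none {s : ITerm S W} {u : Redex S V} (h : u.Matches s) {o : Pos}
    (ho : u.rule.lhs.sym o ≠ none) : s.sym (u.pos ++ o) ≠ none := by
  induction o using List.reverseRecOn with
  | nil =>
    obtain ⟨f, hf⟩ := u.rule.lhs_not_var
    rw [h _ _ hf]
    simp
  | append_singleton o i ih =>
    obtain ⟨f, hf, hi⟩ := (u.rule.lhs.child o i).1 ho
    rw [← List.append_assoc]
    exact child_ne_none (h _ _ hf) hi

theorem Redex.Matches.pos_ne_none {s : ITerm S W} {u : Redex S V} (h : u.Matches s) :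
    s.sym u.pos ≠ none := by
  simpa using h.ne_none u.rule.lhs.root

/-- A redex of a left-linear rule can be contracted. -/
theorem Redex.Matches.exists_contraction {s : ITerm S W} {u : Redex S V} (h : u.Matches s)
    (hl : u.rule.LeftLinear) : ∃ (θ : V → ITerm S W) (N : ITerm S W),
      s.IsSubtermAt u.pos (u.rule.lhs.subst θ) ∧ s.IsReplaceAt u.pos (u.rule.rhs.subst θ) N := by
  classical
  let θ : V → ITerm S W := fun x =>
    if hx : ∃ o, u.rule.lhs.sym o = some (Sum.inr x) then
      s.subtermAt (u.pos ++ hx.choose) (h.ne_none (by rw [hx.choose_spec]; simp))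
    else s
  have hθ : ∀ x o r, u.rule.lhs.sym o = some (Sum.inr x) →
      (θ x).sym r = s.sym (u.pos ++ (o ++ r)) := by
    intro x o r ho
    have hx : ∃ o, u.rule.lhs.sym o = some (Sum.inr x) := ⟨o, ho⟩
    have h1 : hx.choose = o := hl x _ _ hx.choose_spec ho
    simp only [θ, dif_pos hx, subtermAt]
    rw [h1, List.append_assoc]
  have hsub : u.rule.lhs.subst θ = s.subtermAt u.pos h.pos_ne_none := by
    apply subst_eq_of
    · exact h
    · intro o x r a ho hr
      rw [← hr, hθ x o r ho]
      rfl
  refine ⟨θ, s.replaceAt u.pos (u.rule.rhs.subst θ) h.pos_ne_none, fun q => ?_,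
    isReplaceAt_replaceAt _ _ _ _⟩
  rw [hsub]
  rfl

theorem Redex.Matches.exists_contr {s : ITerm S W} {u : Redex S V} (h : u.Matches s)
    (hl : u.rule.LeftLinear) : ∃ N, Contr s u N := by
  obtain ⟨θ, N, h1, h2⟩ := h.exists_contraction hl
  exact ⟨N, contr_of_isReplaceAt h1 h2⟩

/-! ### Overlapping redexes of a weakly orthogonal system have the same contraction -/

section Unify

/- `a` is the term at the overlap position of the outer left-hand side and `b` the inner left-hand
side; they are linear and share no variables. -/
variable (a b : ITerm S V)

open Classical in
/-- The most general unifier of two linear terms without common variables that have a common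
instance: a variable of one term at a position of the other is sent to the subterm there. If both
terms have a variable at the same position, the one of `a` is sent to the one of `b`. -/
noncomputable def linearUnifier (z : V) : ITerm S V :=
  if h : ∃ o, a.sym o = some (Sum.inr z) ∧ b.sym o ≠ none then
    b.subtermAt h.choose h.choose_spec.2
  else if h : ∃ o, b.sym o = some (Sum.inr z) ∧ ∃ f, a.sym o = some (Sum.inl f) then
    a.subtermAt h.choose (by obtain ⟨f, hf⟩ := h.choose_spec.2; simp [hf])
  else var z

variable {a b}
variable (ha : ∀ x p q, a.sym p = some (Sum.inr x) → a.sym q = some (Sum.inr x) → p = q)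
  (hb : ∀ x p q, b.sym p = some (Sum.inr x) → b.sym q = some (Sum.inr x) → p = q)
  (hab : ∀ x p q, a.sym p = some (Sum.inr x) → b.sym q ≠ some (Sum.inr x))

include ha in
theorem linearUnifier_left {o : Pos} {z : V} (ho : a.sym o = some (Sum.inr z))
    (hbo : b.sym o ≠ none) (r : Pos) : (linearUnifier a b z).sym r = b.sym (o ++ r) := by
  have h : ∃ o, a.sym o = some (Sum.inr z) ∧ b.sym o ≠ none := ⟨o, ho, hbo⟩
  have h1 : h.choose = o := ha z _ _ h.choose_spec.1 ho
  rw [linearUnifier, dif_pos h]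
  simp only [subtermAt]
  rw [h1]

include ha hab in
theorem linearUnifier_left_var {o : Pos} {z : V} (ho : a.sym o = some (Sum.inr z))
    (hbo : b.sym o = none) : linearUnifier a b z = var z := by
  rw [linearUnifier, dif_neg, dif_neg]
  · rintro ⟨o', h1, -⟩
    exact hab _ _ _ ho h1
  · rintro ⟨o', h1, h2⟩
    rw [ha _ _ _ h1 ho] at h2
    exact h2 hbo

include hb hab in
theorem linearUnifier_right {o : Pos} {z : V} {f : S.Sym} (ho : b.sym o = some (Sum.inr z))
    (hao : a.sym o = some (Sum.inl f)) (r : Pos) :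
    (linearUnifier a b z).sym r = a.sym (o ++ r) := by
  have h : ∃ o, b.sym o = some (Sum.inr z) ∧ ∃ f, a.sym o = some (Sum.inl f) := ⟨o, ho, f, hao⟩
  have h1 : h.choose = o := hb z _ _ h.choose_spec.1 ho
  rw [linearUnifier, dif_neg, dif_pos h]
  · simp only [subtermAt]
    rw [h1]
  · rintro ⟨o', h1, -⟩
    exact hab _ _ _ h1 ho

include hb hab in
theorem linearUnifier_right_var {o : Pos} {z : V} (ho : b.sym o = some (Sum.inr z))
    (hao : ∀ f, a.sym o ≠ some (Sum.inl f)) : linearUnifier a b z = var z := by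
  rw [linearUnifier, dif_neg, dif_neg]
  · rintro ⟨o', h1, f, h2⟩
    rw [hb _ _ _ h1 ho] at h2
    exact hao f h2
  · rintro ⟨o', h1, -⟩
    exact hab _ _ _ h1 ho

include ha hb hab in
/-- Each unifier, into terms of any size over any variables, factors through the most general
one. -/
theorem linearUnifier_subst {η : V → ITerm S W} (h : a.subst η = b.subst η) (z : V) :
    (linearUnifier a b z).subst η = η z := by
  by_cases h1 : ∃ o, a.sym o = some (Sum.inr z) ∧ b.sym o ≠ none
  · obtain ⟨o, ho, hbo⟩ := h1
    have : linearUnifier a b z = b.subtermAt o hbo :=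
      eq_of_le fun q c hc => by rw [← hc, linearUnifier_left ha ho hbo]; rfl
    rw [this]
    apply eq_of_le
    intro q c hc
    rw [subst_subtermAt, ← h, subst_var _ ho] at hc
    exact hc
  · by_cases h2 : ∃ o, b.sym o = some (Sum.inr z) ∧ ∃ f, a.sym o = some (Sum.inl f)
    · obtain ⟨o, ho, f, hf⟩ := h2
      have hao : a.sym o ≠ none := by simp [hf]
      have : linearUnifier a b z = a.subtermAt o hao :=
        eq_of_le fun q c hc => by rw [← hc, linearUnifier_right hb hab ho hf]; rfl
      rw [this]
      apply eq_of_le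
      intro q c hc
      rw [subst_subtermAt, h, subst_var _ ho] at hc
      exact hc
    · rw [linearUnifier, dif_neg h1, dif_neg h2, subst_var_self]

include ha hb hab in
theorem linearUnifier_unifies {η : V → ITerm S W} (h : a.subst η = b.subst η) :
    a.subst (linearUnifier a b) = b.subst (linearUnifier a b) := by
  -- The common instance shows that `a` and `b` do not clash.
  have hpa : ∀ q, b.sym q ≠ none → (∃ f, a.sym q = some (Sum.inl f)) ∨
      ∃ o r x, q = o ++ r ∧ a.sym o = some (Sum.inr x) := by
    intro q hq
    apply subst_cases (θ := η)
    rw [h]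
    rcases hbq : b.sym q with _ | (f | y)
    · exact absurd hbq hq
    · rw [subst_fun hbq]; simp
    · rw [subst_var' hbq]; exact (η y).root
  have hpb : ∀ q, a.sym q ≠ none → (∃ f, b.sym q = some (Sum.inl f)) ∨
      ∃ o r x, q = o ++ r ∧ b.sym o = some (Sum.inr x) := by
    intro q hq
    apply subst_cases (θ := η)
    rw [← h]
    rcases hbq : a.sym q with _ | (f | y)
    · exact absurd hbq hq
    · rw [subst_fun hbq]; simp
    · rw [subst_var' hbq]; exact (η y).root
  have hff : ∀ q f g, a.sym q = some (Sum.inl f) → b.sym q = some (Sum.inl g) → f = g := by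
    intro q f g hf hg
    have h1 := subst_fun (θ := η) hf
    rw [h, subst_fun hg] at h1
    cases h1
    rfl
  apply subst_eq_of
  · intro q f hf
    rcases hpb q (by simp [hf]) with ⟨g, hg⟩ | ⟨o, r, y, rfl, hy⟩
    · rw [hff _ _ _ hf hg]
      exact subst_fun hg
    · obtain ⟨g, hg⟩ := fun_of_fun_append hf
      rw [subst_var _ hy, linearUnifier_right hb hab hy hg, hf]
  · intro o x r c ho hr
    by_cases hbo : b.sym o = none
    · rw [linearUnifier_left_var ha hab ho hbo] at hr
      rcases hpb o (by simp [ho]) with ⟨g, hg⟩ | ⟨o2, r2, y, rfl, hy⟩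
      · simp [hg] at hbo
      · have hr2 : r2 ≠ [] := by
          rintro rfl
          simp [hy] at hbo
        obtain ⟨g, hg⟩ := exists_fun_of_append (t := a) (p := o2) (q := r2) (by simp [ho]) hr2
        rw [List.append_assoc, subst_var _ hy, linearUnifier_right hb hab hy hg,
          ← List.append_assoc]
        cases r with
        | nil => rw [List.append_nil, ho, ← hr]; rfl
        | cons i r => simp [var] at hr
    · rw [linearUnifier_left ha ho hbo] at hr
      rcases c with f | y
      · exact subst_fun hr
      · rw [subst_var' hr, linearUnifier_right_var hb hab hr fun f hf => fun_ne_var_append hf ho rfl]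
        rfl

include ha hb hab in
theorem isMGU_linearUnifier {η : V → ITerm S W} (h : a.subst η = b.subst η)
    (hfa : a.IsFinite) (hfb : b.IsFinite) : IsMGU (linearUnifier a b) a b := by
  have hfin : ∀ (t : ITerm S V) p hp, t.IsFinite → (t.subtermAt p hp).IsFinite := by
    intro t p hp ht
    exact Set.Finite.preimage (f := fun q => p ++ q) (fun x _ y _ hxy => by simpa using hxy) ht
  refine ⟨fun z => ?_, linearUnifier_unifies ha hb hab h, fun θ' hθ' h' =>
    ⟨θ', hθ', fun x => (linearUnifier_subst ha hb hab h' x).symm⟩⟩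
  unfold linearUnifier
  split_ifs
  · exact hfin _ _ _ hfb
  · exact hfin _ _ _ hfa
  · refine (Set.finite_singleton []).subset fun q hq => ?_
    cases q with
    | nil => rfl
    | cons i q => simp [var] at hq

end Unify

theorem rename_isFinite {t : ITerm S V} (g : V → W) (h : t.IsFinite) : (t.rename g).IsFinite :=
  h.subset fun _ hq => rename_ne_none.1 hq

/-- The case of `Contr.eq_of_overlap` in which the second redex sits in the pattern of the first. -/
theorem Contr.eq_of_overlap_below {R : Set (Rule S V)} (hR : WeaklyOrthogonal R) {s N N' : ITerm S W}
    {u v : Redex S V} (hu : u.rule ∈ R) (hv : v.rule ∈ R) (hsu : u.Matches s) (hsv : v.Matches s)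
    (hN : Contr s u N) (hN' : Contr s v N') {p : Pos} {f : S.Sym} (hp : v.pos = u.pos ++ p)
    (hf : u.rule.lhs.sym p = some (Sum.inl f)) : N = N' := by
  by_cases hne : p = [] ∧ u.rule = v.rule
  · have : u = v := Redex.ext (by rw [hp, hne.1, List.append_nil]) hne.2
    subst this
    exact hN.unique hN'
  obtain ⟨θu, M, hu1, hu2⟩ := hsu.exists_contraction (hR.1 _ hu)
  obtain ⟨θv, M', hv1, hv2⟩ := hsv.exists_contraction (hR.1 _ hv)
  let A : ITerm S (V ⊕ V) := u.rule.lhs.rename Sum.inl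
  let b : ITerm S (V ⊕ V) := v.rule.lhs.rename Sum.inr
  have hAp : A.sym p ≠ none := by rw [rename_fun.2 hf]; simp
  let a : ITerm S (V ⊕ V) := A.subtermAt p hAp
  let η : V ⊕ V → ITerm S W := Sum.elim θu θv
  have hA : A.subst η = u.rule.lhs.subst θu := rename_subst _ _ _
  have hB : b.subst η = v.rule.lhs.subst θv := rename_subst _ _ _
  have hη : a.subst η = b.subst η := by
    apply eq_of_le
    intro q c hc
    rw [subst_subtermAt, hA, ← hu1] at hc
    rw [hB, ← hv1, hp, List.append_assoc]
    exact hc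
  have hla : ∀ x p q, a.sym p = some (Sum.inr x) → a.sym q = some (Sum.inr x) → p = q := by
    intro x p1 q1 h1 h2
    obtain ⟨y, hy, rfl⟩ := rename_var h1
    obtain ⟨z, hz, hyz⟩ := rename_var h2
    cases hyz
    simpa using hR.1 _ hu _ _ _ hy hz
  have hlb : ∀ x p q, b.sym p = some (Sum.inr x) → b.sym q = some (Sum.inr x) → p = q := by
    intro x p1 q1 h1 h2
    obtain ⟨y, hy, rfl⟩ := rename_var h1
    obtain ⟨z, hz, hyz⟩ := rename_var h2
    cases hyz
    exact hR.1 _ hv _ _ _ hy hz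
  have hlab : ∀ x p q, a.sym p = some (Sum.inr x) → b.sym q ≠ some (Sum.inr x) := by
    intro x p1 q1 h1 h2
    obtain ⟨y, hy, rfl⟩ := rename_var h1
    obtain ⟨z, hz, hyz⟩ := rename_var h2
    cases hyz
  have hmgu : IsMGU (linearUnifier a b) a b := by
    refine isMGU_linearUnifier hla hlb hlab hη ?_ (rename_isFinite _ v.rule.lhs_finite)
    exact Set.Finite.preimage (f := fun q => p ++ q) (fun x _ y _ hxy => by simpa using hxy)
      (rename_isFinite Sum.inl u.rule.lhs_finite)
  set θ := linearUnifier a b with hθ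
  have hfac : ∀ z, (θ z).subst η = η z := linearUnifier_subst hla hlb hlab hη
  have hfac' : ∀ t : ITerm S (V ⊕ V), (t.subst θ).subst η = t.subst η := by
    intro t
    rw [← subst_subst]
    congr 1
    funext z
    exact hfac z
  have hAθ : (A.subst θ).sym p ≠ none := by rw [subst_fun (rename_fun.2 hf)]; simp
  let s₁ := (u.rule.rhs.rename Sum.inl).subst θ
  let s₂ := (A.subst θ).replaceAt p ((v.rule.rhs.rename Sum.inr).subst θ) hAθ
  have hcp : s₁ = s₂ := hR.2 _ _ ⟨u.rule, hu, v.rule, hv, p, f, a, θ, hf, hne, fun q => rfl, hmgu,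
    rfl, isReplaceAt_replaceAt _ _ _ _⟩
  have h1 : s₁.subst η = u.rule.rhs.subst θu := by
    rw [hfac', rename_subst]
    rfl
  rw [hN.unique (contr_of_isReplaceAt hu1 hu2), hN'.unique (contr_of_isReplaceAt hv1 hv2)]
  have hrep := isReplaceAt_replaceAt (A.subst θ) p ((v.rule.rhs.rename Sum.inr).subst θ) hAθ
  have hs2p : s₂.sym p ≠ none := by
    have := hrep.2.1 []
    rw [List.append_nil] at this
    show s₂.sym p ≠ none
    rw [this]
    exact ITerm.root _
  -- Below the overlap position the instance of `s₂` is the instance of the inner right-hand side.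
  have h2 : ∀ q, (s₂.subst η).sym (p ++ q) = (v.rule.rhs.subst θv).sym q := by
    intro q
    rw [← subst_subtermAt hs2p η q]
    have h3 : s₂.subtermAt p hs2p = (v.rule.rhs.rename Sum.inr).subst θ :=
      eq_of_le fun q c hc => by rw [← hrep.2.1 q]; exact hc
    rw [h3, hfac', rename_subst]
    rfl
  have h4 : ∀ q, ¬ p <+: q → (s₂.subst η).sym q = (u.rule.lhs.subst θu).sym q := by
    have hout := hrep.2.2
    have key : s₂.subst η = (u.rule.lhs.subst θu).replaceAt p (v.rule.rhs.subst θv)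
        (by rw [subst_fun hf]; simp) := by
      have hrep' := isReplaceAt_replaceAt (u.rule.lhs.subst θu) p (v.rule.rhs.subst θv)
        (by rw [subst_fun hf]; simp)
      apply eq_of_le
      intro q c hc
      by_cases hpq : p <+: q
      · obtain ⟨r, rfl⟩ := hpq
        rw [hrep'.2.1, ← h2, hc]
      · rw [hrep'.2.2 q hpq, ← hA, ← hfac', ← hc]
        rcases subst_cases (by rw [hc]; simp) with ⟨g, hg⟩ | ⟨o, r, x, rfl, hx⟩
        · rw [subst_fun hg, subst_fun (by rw [← hout q hpq]; exact hg)]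
        · rw [subst_var _ hx, subst_var (o := o) (x := x)]
          rw [← hout o fun h => hpq (h.trans (List.prefix_append _ _))]
          exact hx
    intro q hq
    rw [key]
    exact (isReplaceAt_replaceAt _ _ _ _).2.2 q hq
  apply eq_of_le
  intro q c hc
  rw [← hc]
  by_cases hvq : v.pos <+: q
  · obtain ⟨r, rfl⟩ := hvq
    rw [hv2.2.1, ← h2, ← hcp, h1, ← hu2.2.1, hp, List.append_assoc]
  · rw [hv2.2.2 q hvq]
    by_cases huq : u.pos <+: q
    · obtain ⟨r, rfl⟩ := huq
      rw [hu2.2.1, ← h1, hcp, h4, ← hu1]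
      rintro ⟨r', rfl⟩
      exact hvq (by rw [hp]; simp)
    · rw [hu2.2.2 q huq]

/-- Two redexes overlap if and only if the root of one lies in the pattern of the other. -/
theorem Redex.overlap_iff {u v : Redex S V} :
    u.Overlap v ↔ v.pos ∈ u.pattern ∨ u.pos ∈ v.pattern := by
  have hroot : ∀ u : Redex S V, u.pos ∈ u.pattern := by
    intro u
    obtain ⟨f, hf⟩ := u.rule.lhs_not_var
    exact ⟨[], f, hf, by simp⟩
  constructor
  · rintro ⟨z, ⟨q, f, hf, rfl⟩, ⟨q', f', hf', h⟩⟩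
    rcases List.append_eq_append_iff.1 h with ⟨a, h1, rfl⟩ | ⟨a, h1, rfl⟩
    · left
      obtain ⟨g, hg⟩ := fun_of_fun_append hf
      exact ⟨a, g, hg, h1⟩
    · right
      obtain ⟨g, hg⟩ := fun_of_fun_append hf'
      exact ⟨a, g, hg, h1⟩
  · rintro (h | h)
    · exact ⟨_, h, hroot v⟩
    · exact ⟨_, hroot u, h⟩

/-- Contracting either of two overlapping redexes yields the same term. -/
theorem Contr.eq_of_overlap {R : Set (Rule S V)} (hR : WeaklyOrthogonal R) {s N N' : ITerm S W}
    {u v : Redex S V} (hu : u.rule ∈ R) (hv : v.rule ∈ R) (hsu : u.Matches s) (hsv : v.Matches s)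
    (hN : Contr s u N) (hN' : Contr s v N') (h : u.Overlap v) : N = N' := by
  rcases Redex.overlap_iff.1 h with ⟨p, f, hf, hp⟩ | ⟨p, f, hf, hp⟩
  · exact hN.eq_of_overlap_below hR hu hv hsu hsv hN' hp hf
  · exact (hN'.eq_of_overlap_below hR hv hu hsv hsu hN hp hf).symm

/-! ### Patterns and residuals -/

theorem Redex.pos_mem_pattern (u : Redex S V) : u.pos ∈ u.pattern := by
  obtain ⟨f, hf⟩ := u.rule.lhs_not_var
  exact ⟨[], f, hf, by simp⟩

theorem Redex.pos_prefix_of_mem_pattern {u : Redex S V} {p : Pos} (h : p ∈ u.pattern) :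
    u.pos <+: p := by
  obtain ⟨q, f, -, rfl⟩ := h
  exact List.prefix_append _ _

theorem Redex.mem_pattern_append {u : Redex S V} {q : Pos} :
    u.pos ++ q ∈ u.pattern ↔ ∃ f, u.rule.lhs.sym q = some (Sum.inl f) := by
  constructor
  · rintro ⟨q', f, hf, h⟩
    rw [List.append_cancel_left h]
    exact ⟨f, hf⟩
  · rintro ⟨f, hf⟩
    exact ⟨q, f, hf, rfl⟩

/-- Patterns are closed under going up as far as the root of the redex. -/
theorem Redex.mem_pattern_of_prefix {u : Redex S V} {p k : Pos} (h : p ∈ u.pattern)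
    (hk : u.pos <+: k) (hkp : k <+: p) : k ∈ u.pattern := by
  obtain ⟨m, rfl⟩ := hk
  obtain ⟨r, rfl⟩ := hkp
  rw [List.append_assoc, Redex.mem_pattern_append] at h
  obtain ⟨f, hf⟩ := h
  exact Redex.mem_pattern_append.2 (fun_of_fun_append hf)

theorem Redex.Matches.exists_fun {s : ITerm S W} {u : Redex S V} (h : u.Matches s) {p : Pos}
    (hp : p ∈ u.pattern) : ∃ f, s.sym p = some (Sum.inl f) := by
  obtain ⟨q, f, hf, rfl⟩ := hp
  exact ⟨f, h _ _ hf⟩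

theorem Redex.overlap_of_mem {u v : Redex S V} {p : Pos} (hu : p ∈ u.pattern)
    (hv : p ∈ v.pattern) : u.Overlap v := ⟨p, hu, hv⟩

theorem Redex.overlap_of_pos_eq {u v : Redex S V} (h : u.pos = v.pos) : u.Overlap v :=
  ⟨u.pos, u.pos_mem_pattern, h ▸ v.pos_mem_pattern⟩

theorem Redex.Overlap.symm {u v : Redex S V} (h : u.Overlap v) : v.Overlap u := by
  rwa [Redex.Overlap, Set.inter_comm]

theorem Redex.lhs_var_ne_nil (u : Redex S V) {o : Pos} {x : V}
    (h : u.rule.lhs.sym o = some (Sum.inr x)) : o ≠ [] := by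
  rintro rfl
  obtain ⟨f, hf⟩ := u.rule.lhs_not_var
  simp [hf] at h

/-- The members of `U` pairwise do not overlap. -/
def NonOverlapping (U : Set (Redex S V)) : Prop :=
  ∀ u ∈ U, ∀ v ∈ U, u.Overlap v → u = v

/-- The residuals of the members of `U` after contraction of `u`. -/
def residuals (u : Redex S V) (U : Set (Redex S V)) : Set (Redex S V) :=
  {w' | ∃ w ∈ U, u.IsResidual w w'}

/-- A residual below the contracted redex sits below a variable of the right-hand side. -/
theorem exists_of_mem_residuals {u w' : Redex S V} {U : Set (Redex S V)}
    (hw' : w' ∈ residuals u U) (hp : u.pos <+: w'.pos) : ∃ w ∈ U, ∃ x o o' q,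
      w'.rule = w.rule ∧ u.rule.lhs.sym o = some (Sum.inr x) ∧
      u.rule.rhs.sym o' = some (Sum.inr x) ∧ w.pos = u.pos ++ (o ++ q) ∧
      w'.pos = u.pos ++ (o' ++ q) := by
  obtain ⟨w, hw, hr, ⟨h1, h2⟩ | ⟨x, o, o', q, h1, h2, h3, h4⟩⟩ := hw'
  · exact absurd (h2 ▸ hp) h1
  · exact ⟨w, hw, x, o, o', q, hr, h1, h2, by rw [h3, List.append_assoc],
      by rw [h4, List.append_assoc]⟩

theorem mem_of_mem_residuals {u w' : Redex S V} {U : Set (Redex S V)}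
    (hw' : w' ∈ residuals u U) (hp : ¬ u.pos <+: w'.pos) : w' ∈ U := by
  obtain ⟨w, hw, hr, ⟨h1, h2⟩ | ⟨x, o, o', q, h1, h2, h3, h4⟩⟩ := hw'
  · rwa [Redex.ext h2 hr]
  · exact absurd (by rw [h4, List.append_assoc]; exact List.prefix_append _ _) hp

theorem mem_residuals_of_not_prefix {u w : Redex S V} {U : Set (Redex S V)} (hw : w ∈ U)
    (hp : ¬ u.pos <+: w.pos) : w ∈ residuals u U :=
  ⟨w, hw, rfl, Or.inl ⟨hp, rfl⟩⟩

theorem mem_residuals_of_arg {u w : Redex S V} {U : Set (Redex S V)} {x : V} {o o' q : Pos}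
    (hw : w ∈ U) (ho : u.rule.lhs.sym o = some (Sum.inr x))
    (ho' : u.rule.rhs.sym o' = some (Sum.inr x)) (hp : w.pos = u.pos ++ (o ++ q)) :
    (⟨u.pos ++ (o' ++ q), w.rule⟩ : Redex S V) ∈ residuals u U :=
  ⟨w, hw, rfl, Or.inr ⟨x, o, o', q, ho, ho', by rw [hp, List.append_assoc],
    by simp⟩⟩

/-- A residual at the position corresponding to an argument position comes from a redex there. -/
theorem exists_of_mem_residuals_arg {u w' : Redex S V} {U : Set (Redex S V)}
    (hl : u.rule.LeftLinear) {x : V} {o o' q : Pos}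
    (ho : u.rule.lhs.sym o = some (Sum.inr x)) (ho' : u.rule.rhs.sym o' = some (Sum.inr x))
    (hw' : w' ∈ residuals u U) (hp : w'.pos = u.pos ++ (o' ++ q)) :
    ∃ w ∈ U, w'.rule = w.rule ∧ w.pos = u.pos ++ (o ++ q) := by
  obtain ⟨w, hw, x1, o1, o1', q1, hr, h1, h2, h3, h4⟩ :=
    exists_of_mem_residuals hw' (by rw [hp]; exact List.prefix_append _ _)
  rw [hp] at h4
  obtain ⟨rfl, rfl, rfl⟩ := var_append_inj ho' h2 (List.append_cancel_left h4)
  rw [hl _ _ _ h1 ho] at h3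
  exact ⟨w, hw, hr, h3⟩

theorem no_residual_at_fun {u w' : Redex S V} {U : Set (Redex S V)} {m : Pos} {f : S.Sym}
    (hm : u.rule.rhs.sym m = some (Sum.inl f)) (hw' : w' ∈ residuals u U) :
    w'.pos ≠ u.pos ++ m := by
  intro hp
  obtain ⟨w, hw, x1, o1, o1', q1, hr, h1, h2, h3, h4⟩ :=
    exists_of_mem_residuals hw' (by rw [hp]; exact List.prefix_append _ _)
  rw [hp] at h4
  exact fun_ne_var_append hm h2 (List.append_cancel_left h4)

/-- The pattern of a redex that is not at or below `u` does not reach down to `u`. -/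
theorem not_mem_pattern_above {U : Set (Redex S V)} (hU : NonOverlapping U) {u w : Redex S V}
    (hu : u ∈ U) (hw : w ∈ U) (h : ¬ u.pos <+: w.pos) {z : Pos} (hz : u.pos <+: z) :
    z ∉ w.pattern := by
  intro hzw
  have h1 := Redex.pos_prefix_of_mem_pattern hzw
  have h2 : w.pos <+: u.pos := by
    rcases List.prefix_or_prefix_of_prefix h1 hz with h3 | h3
    · exact h3
    · exact absurd h3 h
  have h4 := Redex.mem_pattern_of_prefix hzw h2 hz
  have : w = u := hU _ hw _ hu (Redex.overlap_of_mem h4 u.pos_mem_pattern)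
  subst this
  exact h List.prefix_rfl

theorem nonOverlapping_residuals {U : Set (Redex S V)} (hU : NonOverlapping U) {u : Redex S V}
    (hu : u ∈ U) (hl : u.rule.LeftLinear) : NonOverlapping (residuals u U) := by
  -- By symmetry the root of the second redex may be taken to lie in the pattern of the first.
  have key : ∀ w ∈ residuals u U, ∀ w' ∈ residuals u U, w'.pos ∈ w.pattern → w = w' := by
    intro w hw w' hw' h
    by_cases hp : u.pos <+: w.pos
    · obtain ⟨z, hz, x, o, o', q, hr, ho, ho', h3, h4⟩ := exists_of_mem_residuals hw hp
      obtain ⟨m, f, hm, hwm⟩ := h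
      rw [h4] at hwm
      have hwm' : w'.pos = u.pos ++ (o' ++ (q ++ m)) := by simp [hwm]
      obtain ⟨z', hz', hr', h5⟩ := exists_of_mem_residuals_arg hl ho ho' hw' hwm'
      have hov : z = z' := by
        refine hU _ hz _ hz' (Redex.overlap_iff.2 (Or.inl ⟨m, f, ?_, ?_⟩))
        · rw [← hr]; exact hm
        · rw [h5, h3]; simp
      subst hov
      refine Redex.ext ?_ (hr.trans hr'.symm)
      rw [h3] at h5
      have : m = [] := by
        have := congrArg List.length h5
        simp at this
        exact this
      rw [hwm', h4, this, List.append_nil]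
    · have h1 := mem_of_mem_residuals hw hp
      by_cases hp' : u.pos <+: w'.pos
      · exact absurd h (not_mem_pattern_above hU hu h1 hp hp')
      · exact hU _ h1 _ (mem_of_mem_residuals hw' hp')
          (Redex.overlap_of_mem h w'.pos_mem_pattern)
  intro w hw w' hw' h
  rcases Redex.overlap_iff.1 h with h | h
  · exact key _ hw _ hw' h
  · exact (key _ hw' _ hw h).symm

theorem matches_residuals {t t' : ITerm S W} {U : Set (Redex S V)} (hU : NonOverlapping U)
    {u : Redex S V} (hu : u ∈ U) (hc : Contr t u t') (hm : ∀ w ∈ U, w.Matches t) :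
    ∀ w ∈ residuals u U, w.Matches t' := by
  intro w' hw' q f hq
  by_cases hp : u.pos <+: w'.pos
  · obtain ⟨w, hw, x, o, o', r, hr, ho, ho', h3, h4⟩ := exists_of_mem_residuals hw' hp
    rw [h4, List.append_assoc, List.append_assoc, hc.arg _ _ _ _ ho ho']
    have := hm w hw q f (hr ▸ hq)
    rw [h3] at this
    simpa using this
  · have hw := mem_of_mem_residuals hw' hp
    rw [hc.outside]
    · exact hm _ hw _ _ hq
    · intro hpre
      exact not_mem_pattern_above hU hu hw hp hpre ⟨q, f, hq, rfl⟩

theorem residuals_singleton (u : Redex S V) : residuals u {u} = ∅ := by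
  ext w'
  simp only [Set.mem_empty_iff_false, iff_false]
  rintro ⟨w, rfl, -, ⟨h, -⟩ | ⟨x, o, o', q, h1, -, h2, -⟩⟩
  · exact h List.prefix_rfl
  · refine w.lhs_var_ne_nil h1 ?_
    have := congrArg List.length h2
    simp at this
    exact this.1

/-! ### Developments as evaluations -/

/-- `Eval t U p q a`: developing the members of `U` in the subterm of `t` at `p` yields a term that
has the label `a` at position `q`. A derivation follows one path through `t`: outside the redexes
of `U` it descends with `q`; at the root of a redex it reads the right-hand side, until it meets a
variable and continues at the argument matched by that variable. The inductive definition leaves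
out precisely the paths that run forever through collapsing redexes. The variables of `t` need not
be those of the rules. -/
inductive Eval (t : ITerm S W) (U : Set (Redex S V)) : Pos → Pos → S.Sym ⊕ W → Prop
  | here {p a} (hp : ∀ u ∈ U, u.pos ≠ p) (ha : t.sym p = some a) : Eval t U p [] a
  | down {p i q a f} (hp : ∀ u ∈ U, u.pos ≠ p) (hf : t.sym p = some (Sum.inl f))
      (hi : i < S.arity f) (h : Eval t U (p ++ [i]) q a) : Eval t U p (i :: q) a
  | emit {p q f} (u : Redex S V) (hu : u ∈ U) (hp : u.pos = p)
      (hf : u.rule.rhs.sym q = some (Sum.inl f)) : Eval t U p q (Sum.inl f)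
  | jump {p q a} (u : Redex S V) (hu : u ∈ U) (hp : u.pos = p) (x : V) (o o' r : Pos)
      (ho : u.rule.lhs.sym o = some (Sum.inr x)) (ho' : u.rule.rhs.sym o' = some (Sum.inr x))
      (hq : q = o' ++ r) (h : Eval t U (p ++ o) r a) : Eval t U p q a

/-- Developing no redex returns the term itself. -/
theorem eval_empty {t : ITerm S W} {p q : Pos} {a : S.Sym ⊕ W} :
    Eval t (∅ : Set (Redex S V)) p q a ↔ t.sym (p ++ q) = some a := by
  constructor
  · intro h
    induction h with
    | here hp ha => simpa using ha
    | down hp hf hi h ih => simpa using ih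
    | emit u hu => exact hu.elim
    | jump u hu => exact hu.elim
  · induction q generalizing p with
    | nil => exact fun h => Eval.here (by simp) (by simpa using h)
    | cons i q ih =>
      intro h
      have h' : t.sym ((p ++ [i]) ++ q) = some a := by simpa using h
      have hi : t.sym (p ++ [i]) ≠ none := sym_ne_none_of_append (q := q) (by rw [h']; simp)
      obtain ⟨f, hf, hi'⟩ := (t.child _ _).1 hi
      exact Eval.down (by simp) hf hi' (ih h')

/-- An evaluation passes unchanged through positions without redexes. -/
theorem Eval.walk {t : ITerm S W} {U : Set (Redex S V)} {q : Pos} {a : S.Sym ⊕ W} {m p : Pos}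
    (hm : t.sym (p ++ m) ≠ none) (hk : ∀ k, k <+: m → k ≠ m → ∀ u ∈ U, u.pos ≠ p ++ k)
    (h : Eval t U (p ++ m) q a) : Eval t U p (m ++ q) a := by
  induction m generalizing p with
  | nil => simpa using h
  | cons i m ih =>
    have h1 : t.sym ((p ++ [i]) ++ m) ≠ none := by simpa using hm
    obtain ⟨f, hf, hi⟩ := (t.child _ _).1 (sym_ne_none_of_append h1)
    refine Eval.down (by simpa using hk [] (by simp) (by simp)) hf hi (ih h1 ?_ (by simpa using h))
    intro k hkm hne u hu
    have := hk (i :: k) (by simpa using hkm) (by simpa using hne) u hu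
    simpa using this

theorem Eval.unwalk {t : ITerm S W} {U : Set (Redex S V)} {q : Pos} {a : S.Sym ⊕ W} {m p : Pos}
    (hk : ∀ k, k <+: m → k ≠ m → ∀ u ∈ U, u.pos ≠ p ++ k)
    (h : Eval t U p (m ++ q) a) : Eval t U (p ++ m) q a := by
  induction m generalizing p with
  | nil => simpa using h
  | cons i m ih =>
    have h0 : ∀ u ∈ U, u.pos ≠ p := by simpa using hk [] (by simp) (by simp)
    have h1 : Eval t U (p ++ [i]) (m ++ q) a := by
      cases h with
      | down hp hf hi h => exact h
      | emit u hu hp => exact absurd hp (h0 u hu)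
      | jump u hu hp => exact absurd hp (h0 u hu)
    have := ih (p := p ++ [i]) ?_ h1
    · simpa using this
    intro k hkm hne u hu
    have := hk (i :: k) (by simpa using hkm) (by simpa using hne) u hu
    simpa using this

section Step

variable {t t' : ITerm S W} {U : Set (Redex S V)} {u : Redex S V}

/-- An argument of a redex that is not at or below `u` starts outside the subterm at `u` or exactly
at `u`: otherwise `u` would sit in the pattern of that redex. -/
theorem exit_cases (hU : NonOverlapping U) (hu : u ∈ U) {w : Redex S V} (hw : w ∈ U)
    (hp : ¬ u.pos <+: w.pos) {o : Pos} {x : V} (ho : w.rule.lhs.sym o = some (Sum.inr x)) :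
    ¬ u.pos <+: w.pos ++ o ∨ u.pos = w.pos ++ o := by
  by_cases h : u.pos <+: w.pos ++ o
  · right
    rcases List.prefix_or_prefix_of_prefix h (List.prefix_append w.pos o) with h1 | ⟨k, hk⟩
    · exact absurd h1 hp
    · obtain ⟨l, hl⟩ := h
      rw [← hk, List.append_assoc] at hl
      have hl := List.append_cancel_left hl
      by_cases hnil : l = []
      · rw [← hk, ← hl, hnil, List.append_nil]
      · obtain ⟨f, hf⟩ := exists_fun_of_append (t := w.rule.lhs) (p := k) (q := l)
          (by rw [hl, ho]; simp) hnil
        exact absurd ⟨k, f, hf, hk.symm⟩ (not_mem_pattern_above hU hu hw hp List.prefix_rfl)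
  · exact Or.inl h

/-- Evaluations after a contraction step come from evaluations before it. -/
theorem Eval.of_residuals (hU : NonOverlapping U) (hu : u ∈ U) (hl : u.rule.LeftLinear)
    (hc : Contr t u t') {p q : Pos} {a : S.Sym ⊕ W} (h : Eval t' (residuals u U) p q a)
    (hp : ¬ u.pos <+: p ∨ p = u.pos) : Eval t U p q a := by
  have key : (¬ u.pos <+: p → Eval t U p q a) ∧
      (∀ x o o' r, u.rule.lhs.sym o = some (Sum.inr x) → u.rule.rhs.sym o' = some (Sum.inr x) →
        p = u.pos ++ (o' ++ r) → Eval t U (u.pos ++ (o ++ r)) q a) ∧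
      (∀ m, p = u.pos ++ m → u.rule.rhs.sym m ≠ none → Eval t U u.pos (m ++ q) a) := by
    clear hp
    -- The third clause follows from the second one at a variable of the right-hand side.
    have enter : ∀ {p q : Pos} {a : S.Sym ⊕ W},
        (∀ x o o' r, u.rule.lhs.sym o = some (Sum.inr x) → u.rule.rhs.sym o' = some (Sum.inr x) →
          p = u.pos ++ (o' ++ r) → Eval t U (u.pos ++ (o ++ r)) q a) →
        (∀ m f, p = u.pos ++ m → u.rule.rhs.sym m = some (Sum.inl f) →
          Eval t U u.pos (m ++ q) a) →
        ∀ m, p = u.pos ++ m → u.rule.rhs.sym m ≠ none → Eval t U u.pos (m ++ q) a := by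
      intro p q a h2 h3 m hpm hm
      rcases hr : u.rule.rhs.sym m with _ | (f | x)
      · exact absurd hr hm
      · exact h3 m f hpm hr
      · obtain ⟨o, ho⟩ := u.rule.rhs_vars _ _ hr
        refine Eval.jump u hu rfl x o m q ho hr rfl ?_
        simpa using h2 x o m [] ho hr (by simpa using hpm)
    induction h with
    | @here p a hp ha =>
      have h2 : ∀ x o o' r, u.rule.lhs.sym o = some (Sum.inr x) →
          u.rule.rhs.sym o' = some (Sum.inr x) →
          p = u.pos ++ (o' ++ r) → Eval t U (u.pos ++ (o ++ r)) [] a := by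
        rintro x o o' r ho ho' rfl
        refine Eval.here (fun w hw hwp => hp _ (mem_residuals_of_arg hw ho ho' hwp) rfl) ?_
        rw [← hc.arg _ _ _ _ ho ho', ha]
      refine ⟨fun h => ?_, h2, enter h2 ?_⟩
      · refine Eval.here (fun w hw hwp => ?_) (by rw [← hc.outside _ h, ha])
        exact hp w (mem_residuals_of_not_prefix hw (hwp ▸ h)) hwp
      · rintro m f rfl hf
        rw [hc.fn _ _ hf] at ha
        cases ha
        exact Eval.emit u hu rfl (by simpa using hf)
    | @down p i q a f hp hf hi h ih =>
      obtain ⟨ih1, ih2, ih3⟩ := ih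
      have h2 : ∀ x o o' r, u.rule.lhs.sym o = some (Sum.inr x) →
          u.rule.rhs.sym o' = some (Sum.inr x) →
          p = u.pos ++ (o' ++ r) → Eval t U (u.pos ++ (o ++ r)) (i :: q) a := by
        rintro x o o' r ho ho' rfl
        refine Eval.down (fun w hw hwp => hp _ (mem_residuals_of_arg hw ho ho' hwp) rfl)
          (f := f) ?_ hi ?_
        · rw [← hc.arg _ _ _ _ ho ho', hf]
        · simpa using ih2 x o o' (r ++ [i]) ho ho' (by simp)
      refine ⟨fun h => ?_, h2, enter h2 ?_⟩
      · refine Eval.down (fun w hw hwp => ?_) (by rw [← hc.outside _ h, hf]) hi ?_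
        · exact hp w (mem_residuals_of_not_prefix hw (hwp ▸ h)) hwp
        · by_cases hpi : u.pos <+: p ++ [i]
          · rcases List.prefix_concat_iff.1 hpi with h1 | h1
            · rw [← h1]
              simpa using ih3 [] (by simpa using h1.symm) (ITerm.root _)
            · exact absurd h1 h
          · exact ih1 hpi
      · rintro m g rfl hg
        rw [hc.fn _ _ hg] at hf
        cases hf
        simpa using ih3 (m ++ [i]) (by simp) (child_ne_none hg hi)
    | @emit p q f w' hw' hp hf =>
      have h2 : ∀ x o o' r, u.rule.lhs.sym o = some (Sum.inr x) →
          u.rule.rhs.sym o' = some (Sum.inr x) →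
          p = u.pos ++ (o' ++ r) → Eval t U (u.pos ++ (o ++ r)) q (Sum.inl f) := by
        rintro x o o' r ho ho' rfl
        obtain ⟨w, hw, hr, hwp⟩ := exists_of_mem_residuals_arg hl ho ho' hw' hp
        exact Eval.emit w hw hwp (hr ▸ hf)
      refine ⟨fun h => ?_, h2, enter h2 ?_⟩
      · exact Eval.emit w' (mem_of_mem_residuals hw' (hp ▸ h)) hp hf
      · rintro m g rfl hg
        exact absurd hp (no_residual_at_fun hg hw')
    | @jump p q a w' hw' hp x1 o1 o1' r1 ho1 ho1' hq h ih =>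
      obtain ⟨ih1, ih2, ih3⟩ := ih
      have h2 : ∀ x o o' r, u.rule.lhs.sym o = some (Sum.inr x) →
          u.rule.rhs.sym o' = some (Sum.inr x) →
          p = u.pos ++ (o' ++ r) → Eval t U (u.pos ++ (o ++ r)) q a := by
        rintro x o o' r ho ho' rfl
        obtain ⟨w, hw, hr, hwp⟩ := exists_of_mem_residuals_arg hl ho ho' hw' hp
        refine Eval.jump w hw hwp x1 o1 o1' r1 (hr ▸ ho1) (hr ▸ ho1') hq ?_
        simpa using ih2 x o o' (r ++ o1) ho ho' (by simp)
      refine ⟨fun h => ?_, h2, enter h2 ?_⟩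
      · have hw := mem_of_mem_residuals hw' (hp ▸ h)
        refine Eval.jump w' hw hp x1 o1 o1' r1 ho1 ho1' hq ?_
        subst hp
        rcases exit_cases hU hu hw h ho1 with h3 | h3
        · exact ih1 h3
        · rw [← h3]
          simpa using ih3 [] (by simpa using h3.symm) (ITerm.root _)
      · rintro m g rfl hg
        exact absurd hp (no_residual_at_fun hg hw')
  rcases hp with hp | hp
  · exact key.1 hp
  · rw [hp]
    simpa using key.2.2 [] (by simpa using hp) (ITerm.root _)

/-- Evaluations before a contraction step yield evaluations after it. -/
theorem Eval.to_residuals (hU : NonOverlapping U) (hu : u ∈ U) (hl : u.rule.LeftLinear)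
    (hm : u.Matches t) (hc : Contr t u t') {p q : Pos} {a : S.Sym ⊕ W} (h : Eval t U p q a)
    (hp : ¬ u.pos <+: p ∨ p = u.pos) : Eval t' (residuals u U) p q a := by
  have hroot : t'.sym u.pos ≠ none := by
    rcases hr : u.rule.rhs.sym [] with _ | (f | x)
    · exact absurd hr (ITerm.root _)
    · have := hc.fn _ _ hr
      rw [List.append_nil] at this
      simp [this]
    · obtain ⟨o, ho⟩ := u.rule.rhs_vars _ _ hr
      have := hc.arg _ _ _ [] ho hr
      simp only [List.append_nil] at this
      rw [this]
      exact hm.ne_none (by simp [ho])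
  -- The right-hand side of `u` contains no residuals above its variables.
  have hwalk : ∀ {m q : Pos} {a : S.Sym ⊕ W}, u.rule.rhs.sym m ≠ none →
      Eval t' (residuals u U) (u.pos ++ m) q a → Eval t' (residuals u U) u.pos (m ++ q) a := by
    intro m q a hmm h
    refine h.walk ?_ ?_
    · induction m using List.reverseRecOn with
      | nil => simpa using hroot
      | append_singleton m i _ =>
        obtain ⟨f, hf, hi⟩ := (u.rule.rhs.child m i).1 hmm
        rw [← List.append_assoc]
        exact child_ne_none (hc.fn _ _ hf) hi
    · rintro k ⟨l, rfl⟩ hne w hw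
      obtain ⟨f, hf⟩ := exists_fun_of_append (t := u.rule.rhs) hmm (by rintro rfl; simp at hne)
      exact no_residual_at_fun hf hw
  have key : (¬ u.pos <+: p → Eval t' (residuals u U) p q a) ∧
      (∀ x o o' r, u.rule.lhs.sym o = some (Sum.inr x) → u.rule.rhs.sym o' = some (Sum.inr x) →
        p = u.pos ++ (o ++ r) → Eval t' (residuals u U) (u.pos ++ (o' ++ r)) q a) ∧
      (p = u.pos → Eval t' (residuals u U) p q a) := by
    clear hp
    induction h with
    | @here p a hp ha =>
      refine ⟨fun h => ?_, ?_, fun h => absurd h.symm (hp u hu)⟩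
      · refine Eval.here (fun w' hw' hwp => ?_) (by rw [hc.outside _ h, ha])
        exact hp w' (mem_of_mem_residuals hw' (hwp ▸ h)) hwp
      · rintro x o o' r ho ho' rfl
        refine Eval.here (fun w' hw' hwp => ?_) (by rw [hc.arg _ _ _ _ ho ho', ha])
        obtain ⟨w, hw, -, hwp⟩ := exists_of_mem_residuals_arg hl ho ho' hw' hwp
        exact hp w hw hwp
    | @down p i q a f hp hf hi h ih =>
      obtain ⟨ih1, ih2, ih3⟩ := ih
      refine ⟨fun h => ?_, ?_, fun h => absurd h.symm (hp u hu)⟩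
      · refine Eval.down (fun w' hw' hwp => ?_) (by rw [hc.outside _ h, hf]) hi ?_
        · exact hp w' (mem_of_mem_residuals hw' (hwp ▸ h)) hwp
        · by_cases hpi : u.pos <+: p ++ [i]
          · rcases List.prefix_concat_iff.1 hpi with h1 | h1
            · exact ih3 h1.symm
            · exact absurd h1 h
          · exact ih1 hpi
      · rintro x o o' r ho ho' rfl
        refine Eval.down (fun w' hw' hwp => ?_) (by rw [hc.arg _ _ _ _ ho ho', hf]) hi ?_
        · obtain ⟨w, hw, -, hwp⟩ := exists_of_mem_residuals_arg hl ho ho' hw' hwp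
          exact hp w hw hwp
        · simpa using ih2 x o o' (r ++ [i]) ho ho' (by simp)
    | @emit p q f w hw hp hf =>
      refine ⟨fun h => ?_, ?_, fun h => ?_⟩
      · exact Eval.emit w (mem_residuals_of_not_prefix hw (hp ▸ h)) hp hf
      · rintro x o o' r ho ho' rfl
        exact Eval.emit _ (mem_residuals_of_arg hw ho ho' hp) rfl hf
      · have : w = u := hU _ hw _ hu (Redex.overlap_of_pos_eq (hp.trans h))
        subst this
        have h1 := hc.fn _ _ hf
        rw [h]
        have h2 : Eval t' (residuals w U) (w.pos ++ q) [] (Sum.inl f) :=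
          Eval.here (fun w' hw' => no_residual_at_fun hf hw') h1
        simpa using hwalk (by simp [hf]) h2
    | @jump p q a w hw hp x1 o1 o1' r1 ho1 ho1' hq h ih =>
      obtain ⟨ih1, ih2, ih3⟩ := ih
      refine ⟨fun h => ?_, ?_, fun h => ?_⟩
      · refine Eval.jump w (mem_residuals_of_not_prefix hw (hp ▸ h)) hp x1 o1 o1' r1 ho1 ho1' hq ?_
        subst hp
        rcases exit_cases hU hu hw h ho1 with h3 | h3
        · exact ih1 h3
        · exact ih3 h3.symm
      · rintro x o o' r ho ho' rfl
        refine Eval.jump _ (mem_residuals_of_arg hw ho ho' hp) rfl x1 o1 o1' r1 ho1 ho1' hq ?_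
        simpa using ih2 x o o' (r ++ o1) ho ho' (by simp)
      · have : w = u := hU _ hw _ hu (Redex.overlap_of_pos_eq (hp.trans h))
        subst this
        subst hp hq
        have := ih2 x1 o1 o1' [] ho1 ho1' (by simp)
        exact hwalk (by simp [ho1']) (by simpa using this)
  rcases hp with hp | hp
  · exact key.1 hp
  · exact key.2.2 hp

end Step

/-- Developing a single redex is contracting it. -/
theorem eval_singleton {t N : ITerm S W} {u : Redex S V} (hl : u.rule.LeftLinear)
    (hm : u.Matches t) (hc : Contr t u N) {p q : Pos} {a : S.Sym ⊕ W} (hp : p <+: u.pos) :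
    Eval t {u} p q a ↔ N.sym (p ++ q) = some a := by
  have hU : NonOverlapping {u} := by
    rintro _ rfl _ rfl -
    rfl
  have hp' : ¬ u.pos <+: p ∨ p = u.pos := by
    by_cases h : u.pos <+: p
    · exact Or.inr (hp.eq_of_length_le h.length_le)
    · exact Or.inl h
  rw [← eval_empty (V := V), ← residuals_singleton u]
  exact ⟨fun h => h.to_residuals hU rfl hl hm hc hp', fun h => h.of_residuals hU rfl hl hc hp'⟩

open Order

/-! ### The result of a development is its evaluation -/

/-- Evaluating the redexes of `U` in `t` yields the term `s`. -/
def Dev (t : ITerm S V) (U : Set (Redex S V)) (s : ITerm S V) : Prop :=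
  ∀ q a, s.sym q = some a → Eval t U [] q a

namespace Development

variable {R : Set (Rule S V)} {t : ITerm S V} {U : Set (Redex S V)}

theorem good (σ : Development R t U) (β : Ordinal.{0}) (hβ : β ≤ σ.length)
    (hR : WeaklyOrthogonal R) :
    NonOverlapping (σ.left β) ∧ ∀ w ∈ σ.left β, w.rule ∈ R := by
  induction β using Ordinal.limitRecOn with
  | zero =>
    rw [σ.left_zero]
    exact ⟨σ.nonOverlapping, fun w hw => (σ.isRedex w hw).1⟩
  | add_one β ih =>
    rw [← Order.succ_eq_add_one] at *
    have hlt : β < σ.length := Order.succ_le_iff.1 hβ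
    obtain ⟨h1, h2⟩ := ih hlt.le
    have hmem := σ.step_mem β hlt
    rw [σ.left_succ β hlt]
    refine ⟨nonOverlapping_residuals h1 hmem (hR.1 _ (h2 _ hmem)), ?_⟩
    rintro w' ⟨w, hw, hr, -⟩
    rw [hr]
    exact h2 _ hw
  | limit l hl ih =>
    have hmem := σ.left_limit l hβ hl
    constructor
    · intro w hw w' hw' h
      obtain ⟨β, hβl, h1⟩ := (hmem w).1 hw
      obtain ⟨β', hβl', h2⟩ := (hmem w').1 hw'
      have hm := max_lt hβl hβl'
      exact (ih _ hm (hm.le.trans hβ)).1 _ (h1 _ (le_max_left _ _) hm) _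
        (h2 _ (le_max_right _ _) hm) h
    · intro w hw
      obtain ⟨β, hβl, h1⟩ := (hmem w).1 hw
      exact (ih _ hβl (hβl.le.trans hβ)).2 _ (h1 _ le_rfl hβl)

/-- Below a limit ordinal, a residual that is too shallow to be affected by the remaining steps
survives to the limit. -/
theorem persists (σ : Development R t U) {l : Ordinal.{0}} (hl : l ≤ σ.length)
    (hlim : IsSuccLimit l) {β : Ordinal.{0}} (hβ : β < l) {w : Redex S V}
    (hdeep : ∀ γ, β ≤ γ → γ < l → w.pos.length < (σ.step γ).pos.length)
    (hw : w ∈ σ.left β) : w ∈ σ.left l := by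
  refine (σ.left_limit l hl hlim w).2 ⟨β, hβ, ?_⟩
  intro γ
  induction γ using Ordinal.limitRecOn with
  | zero =>
    intro h _
    rwa [← le_antisymm h zero_le]
  | add_one γ ih =>
    rw [← Order.succ_eq_add_one]
    intro h hγ
    rcases h.lt_or_eq with h1 | h1
    · have h2 := Order.lt_succ_iff.1 h1
      have h3 := (Order.lt_succ γ).trans hγ
      rw [σ.left_succ γ (h3.trans_le hl)]
      exact mem_residuals_of_not_prefix (ih h2 h3) fun hp =>
        absurd hp.length_le (not_le.2 (hdeep γ h2 h3))
    · rwa [← h1]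
  | limit γ hγlim ih =>
    intro h hγ
    rcases h.lt_or_eq with h1 | h1
    · exact (σ.left_limit γ (hγ.le.trans hl) hγlim w).2
        ⟨β, h1, fun γ' h2 h3 => ih γ' h3 h2 (h3.trans hγ)⟩
    · rwa [← h1]

/-- An evaluation at a limit ordinal inspects finitely many positions and redexes only, hence it
exists already below the limit. -/
theorem eval_below_limit (σ : Development R t U) {l : Ordinal.{0}} (hl : l ≤ σ.length)
    (hlim : IsSuccLimit l) {p q : Pos} {a : S.Sym ⊕ V}
    (h : Eval (σ.term l) (σ.left l) p q a) :
    ∃ β < l, ∀ γ, β ≤ γ → γ < l → Eval (σ.term γ) (σ.left γ) p q a := by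
  have hno : ∀ p : Pos, (∀ u ∈ σ.left l, u.pos ≠ p) →
      ∃ β < l, ∀ γ, β ≤ γ → γ < l → (∀ u ∈ σ.left γ, u.pos ≠ p) ∧
        (σ.term γ).sym p = (σ.term l).sym p := by
    intro p hp
    obtain ⟨β, hβ, h1⟩ := σ.strong l hl hlim p.length
    obtain ⟨β', hβ', h2⟩ := σ.term_limit l hl hlim p.length
    refine ⟨max β β', max_lt hβ hβ', fun γ hγ hγl => ⟨?_, ?_⟩⟩
    · intro u hu hup
      refine hp u (σ.persists hl hlim hγl ?_ hu) hup
      intro γ' h3 h4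
      rw [hup]
      exact h1 γ' ((le_max_left _ _).trans (hγ.trans h3)) h4
    · exact h2 γ ((le_max_right _ _).trans hγ) hγl p le_rfl
  induction h with
  | @here p a hp ha =>
    obtain ⟨β, hβ, h⟩ := hno p hp
    refine ⟨β, hβ, fun γ h1 h2 => ?_⟩
    obtain ⟨h3, h4⟩ := h γ h1 h2
    exact Eval.here h3 (h4.trans ha)
  | @down p i q a f hp hf hi h ih =>
    obtain ⟨β, hβ, h⟩ := hno p hp
    obtain ⟨β', hβ', ih⟩ := ih
    refine ⟨max β β', max_lt hβ hβ', fun γ h1 h2 => ?_⟩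
    obtain ⟨h3, h4⟩ := h γ ((le_max_left _ _).trans h1) h2
    exact Eval.down h3 (h4.trans hf) hi (ih γ ((le_max_right _ _).trans h1) h2)
  | @emit p q f u hu hp hf =>
    obtain ⟨β, hβ, h⟩ := (σ.left_limit l hl hlim u).1 hu
    exact ⟨β, hβ, fun γ h1 h2 => Eval.emit u (h γ h1 h2) hp hf⟩
  | @jump p q a u hu hp x o o' r ho ho' hq h ih =>
    obtain ⟨β, hβ, h⟩ := (σ.left_limit l hl hlim u).1 hu
    obtain ⟨β', hβ', ih⟩ := ih
    exact ⟨max β β', max_lt hβ hβ', fun γ h1 h2 =>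
      Eval.jump u (h γ ((le_max_left _ _).trans h1) h2) hp x o o' r ho ho' hq
        (ih γ ((le_max_right _ _).trans h1) h2)⟩

theorem eval_of_eval (σ : Development R t U) (hR : WeaklyOrthogonal R) (β : Ordinal.{0})
    (hβ : β ≤ σ.length) {q : Pos} {a : S.Sym ⊕ V} (h : Eval (σ.term β) (σ.left β) [] q a) :
    Eval t U [] q a := by
  induction β using Ordinal.limitRecOn with
  | zero => rwa [σ.left_zero, σ.term_zero] at h
  | add_one β ih =>
    rw [← Order.succ_eq_add_one] at *
    have hlt : β < σ.length := Order.succ_le_iff.1 hβ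
    obtain ⟨h1, h2⟩ := σ.good β hlt.le hR
    have hmem := σ.step_mem β hlt
    rw [σ.left_succ β hlt] at h
    refine ih hlt.le (Eval.of_residuals h1 hmem (hR.1 _ (h2 _ hmem)) (σ.contracts β hlt).contr h ?_)
    rw [List.prefix_nil]
    exact (em _).symm.imp id Eq.symm
  | limit l hl ih =>
    obtain ⟨β, hβl, h1⟩ := σ.eval_below_limit hβ hl h
    exact ih β hβl (hβl.le.trans hβ) (h1 β le_rfl hβl)

/-- The labels of the result of a development are obtained by evaluation. -/
theorem dev_target (σ : Development R t U) (hR : WeaklyOrthogonal R) : Dev t U σ.target := by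
  intro q a h
  refine σ.eval_of_eval hR σ.length le_rfl ?_
  rw [σ.complete, eval_empty]
  exact h

end Development

/-! ### Every evaluation is the result of a development -/

theorem finite_positions (T : ITerm S V) (d : ℕ) :
    {p : Pos | T.sym p ≠ none ∧ p.length ≤ d}.Finite := by
  induction d with
  | zero =>
    refine (Set.finite_singleton []).subset ?_
    rintro p ⟨-, hp⟩
    simpa using hp
  | succ d ih =>
    have hfin : (⋃ p ∈ {p : Pos | T.sym p ≠ none ∧ p.length ≤ d},
        {p' : Pos | T.sym p' ≠ none ∧ ∃ i, p' = p ++ [i]}).Finite := by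
      refine ih.biUnion fun p _ => ?_
      rcases hp : T.sym p with _ | (f | x)
      · refine Set.finite_empty.subset ?_
        rintro _ ⟨h, i, rfl⟩
        exact sym_ne_none_of_append h hp
      · refine ((Set.finite_lt_nat (S.arity f)).image fun i => p ++ [i]).subset ?_
        rintro _ ⟨h, i, rfl⟩
        exact ⟨i, lt_arity hp h, rfl⟩
      · refine Set.finite_empty.subset ?_
        rintro _ ⟨h, i, rfl⟩
        simpa using eq_nil_of_var_append hp h
    refine (ih.union hfin).subset ?_
    rintro p ⟨h, hp⟩
    by_cases hd : p.length ≤ d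
    · exact Or.inl ⟨h, hd⟩
    · right
      rcases List.eq_nil_or_concat p with rfl | ⟨p, i, rfl⟩
      · simp at hd
      · rw [List.concat_eq_append] at *
        simp only [List.length_append, List.length_singleton] at hp
        simp only [Set.mem_iUnion]
        exact ⟨p, ⟨sym_ne_none_of_append h, by omega⟩, h, i, rfl⟩

/-- The code of a position as a natural number. -/
def code (p : Pos) : ℕ := Encodable.encode p

theorem code_injective : Function.Injective code := Encodable.encode_injective

theorem code_le_append (p q : Pos) : code p ≤ code (p ++ q) := by
  induction p with
  | nil => simp [code]
  | cons i p ih =>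
    simp only [code, List.cons_append, Encodable.encode_list_cons] at ih ⊢
    exact Nat.succ_le_succ
      ((strictMono_nat_of_lt_succ fun n => Nat.pair_lt_pair_right i n.lt_succ_self).monotone ih)

theorem code_le_of_prefix {p q : Pos} (h : p <+: q) : code p ≤ code q := by
  obtain ⟨r, rfl⟩ := h
  exact code_le_append p r

theorem code_lt_of_prefix {p q : Pos} (h : p <+: q) (hne : p ≠ q) : code p < code q :=
  lt_of_le_of_ne (code_le_of_prefix h) fun h' => hne (code_injective h')

section Dev

variable {s T : ITerm S V} {U : Set (Redex S V)}

theorem Dev.eval_at (h : Dev s U T) {p : Pos} (hp : ∀ k, k <+: p → k ≠ p → ∀ u ∈ U, u.pos ≠ k)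
    {a : S.Sym ⊕ V} (ha : T.sym p = some a) : Eval s U p [] a := by
  have := Eval.unwalk (p := []) (m := p) (q := []) (by simpa using hp)
    (by simpa using h p a ha)
  simpa using this

/-- Above all redexes the term agrees with the result. -/
theorem Dev.sym_eq (h : Dev s U T) {p : Pos} (hp : ∀ k, k <+: p → ∀ u ∈ U, u.pos ≠ k) :
    s.sym p = T.sym p := by
  have key : ∀ p : Pos, (∀ k, k <+: p → ∀ u ∈ U, u.pos ≠ k) → ∀ a, T.sym p = some a →
      s.sym p = some a := by
    intro p hp a ha
    have := h.eval_at (fun k hk _ => hp k hk) ha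
    cases this with
    | here _ h1 => exact h1
    | emit u hu hup => exact absurd hup (hp p List.prefix_rfl u hu)
    | jump u hu hup => exact absurd hup (hp p List.prefix_rfl u hu)
  rcases hT : T.sym p with _ | a
  · induction p using List.reverseRecOn with
    | nil => exact absurd hT T.root
    | append_singleton p i ih =>
      by_contra hne
      have hp' : ∀ k, k <+: p → ∀ u ∈ U, u.pos ≠ k :=
        fun k hk => hp k (hk.trans (List.prefix_append _ _))
      obtain ⟨f, hf, hi⟩ := (s.child p i).1 hne
      rcases hTp : T.sym p with _ | a
      · simp [ih hp' hTp] at hf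
      · have := key p hp' a hTp
        rw [hf] at this
        cases this
        exact child_ne_none hTp hi hT
  · exact key p hp a hT

theorem Dev.ne_none (h : Dev s U T) {p : Pos} (hp : ∀ k, k <+: p → k ≠ p → ∀ u ∈ U, u.pos ≠ k)
    (hs : s.sym p ≠ none) : T.sym p ≠ none := by
  rcases List.eq_nil_or_concat p with rfl | ⟨p, i, rfl⟩
  · exact T.root
  · rw [List.concat_eq_append] at *
    obtain ⟨f, hf, hi⟩ := (s.child p i).1 hs
    refine child_ne_none ?_ hi (f := f)
    rw [← hf]
    refine (h.sym_eq fun k hk => hp k (hk.trans (List.prefix_append _ _)) ?_).symm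
    rintro rfl
    have := hk.length_le
    simp at this

/-- If the redexes at positions of the result are deep, then no redex at all is shallow. -/
theorem Dev.no_shallow (h : Dev s U T) (hm : ∀ u ∈ U, u.Matches s) {d : ℕ}
    (hd : ∀ u ∈ U, T.sym u.pos ≠ none → d < u.pos.length) {q : Pos} (hq : q.length ≤ d) :
    ∀ k, k <+: q → ∀ u ∈ U, u.pos ≠ k := by
  induction q using List.reverseRecOn with
  | nil =>
    rintro k hk u hu hup
    rw [List.prefix_nil] at hk
    have := hd u hu (by rw [hup, hk]; exact T.root)
    simp [hup, hk] at this
  | append_singleton q i ih =>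
    have ih := ih (by simp at hq; omega)
    intro k hk u hu hup
    rcases List.prefix_concat_iff.1 hk with rfl | hk
    · have h1 : T.sym u.pos ≠ none := by
        refine h.ne_none (fun k hk hne => ?_) (hm u hu).pos_ne_none
        rw [hup] at hk hne
        rcases List.prefix_concat_iff.1 hk with h2 | h2
        · exact absurd h2 hne
        · exact ih k h2
      have := hd u hu h1
      rw [hup] at this
      omega
    · exact ih k hk u hu hup

/-- The redexes of `U` that follow each other from `p` on through collapsing right-hand sides are
`n` in number, not counting a last one that does not collapse. -/
inductive Collapses (U : Set (Redex S V)) : ℕ → Pos → Prop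
  | last {p} (h : ∀ u ∈ U, u.pos = p → ∀ x, u.rule.rhs.sym [] ≠ some (Sum.inr x)) :
      Collapses U 0 p
  | next {n p} (u : Redex S V) (hu : u ∈ U) (hp : u.pos = p) (x : V) (o : Pos)
      (ho : u.rule.lhs.sym o = some (Sum.inr x)) (hx : u.rule.rhs.sym [] = some (Sum.inr x))
      (h : Collapses U n (p ++ o)) : Collapses U (n + 1) p

theorem Eval.exists_collapses (hU : NonOverlapping U) {p q : Pos} {a : S.Sym ⊕ V}
    (h : Eval s U p q a) (hq : q = []) : ∃ n, Collapses U n p := by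
  induction h with
  | @here p a hp ha => exact ⟨0, Collapses.last fun u hu hup => absurd hup (hp u hu)⟩
  | @down p i q a f hp hf hi h ih => cases hq
  | @emit p q f u hu hp hf =>
    subst hq
    refine ⟨0, Collapses.last fun u' hu' hup x hx => ?_⟩
    rw [hU _ hu' _ hu (Redex.overlap_of_pos_eq (hup.trans hp.symm)), hf] at hx
    cases hx
  | @jump p q a u hu hp x o o' r ho ho' hq' h ih =>
    subst hq
    obtain ⟨rfl, rfl⟩ := List.append_eq_nil_iff.1 hq'.symm
    obtain ⟨n, hn⟩ := ih rfl
    exact ⟨n + 1, Collapses.next u hu hp x o ho ho' hn⟩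

theorem Collapses.residuals {u : Redex S V} (hl : u.rule.LeftLinear) {n : ℕ} {p : Pos}
    (h : Collapses U n p) {x : V} {o o' r : Pos} (ho : u.rule.lhs.sym o = some (Sum.inr x))
    (ho' : u.rule.rhs.sym o' = some (Sum.inr x)) (hp : p = u.pos ++ (o ++ r)) :
    Collapses (residuals u U) n (u.pos ++ (o' ++ r)) := by
  induction h generalizing r with
  | @last p h =>
    refine Collapses.last fun w' hw' hwp x => ?_
    obtain ⟨w, hw, hr, hwp'⟩ := exists_of_mem_residuals_arg hl ho ho' hw' hwp
    rw [hr]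
    exact h w hw (hwp'.trans hp.symm) x
  | @next n p w hw hwp y o1 ho1 hx h ih =>
    refine Collapses.next _ (mem_residuals_of_arg hw ho ho' (hwp.trans hp)) rfl y o1 ho1 hx ?_
    have := ih (r := r ++ o1) (by simp [hp])
    simpa using this

end Dev

section Construction

variable {R : Set (Rule S V)} {T : ITerm S V}

/-- A stage of the construction of a development with result `T`: a term with a set of redexes
whose evaluation is `T`. -/
structure Stage (R : Set (Rule S V)) (T : ITerm S V) where
  term : ITerm S V
  left : Set (Redex S V)
  nonOverlapping : NonOverlapping left
  rule_mem : ∀ w ∈ left, w.rule ∈ R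
  isMatch : ∀ w ∈ left, w.Matches term
  dev : Dev term left T

/-- `y` arises from `x` by contracting `r`, the redex of `x` whose position has the least code. -/
structure Stage.Step (x : Stage R T) (r : Redex S V) (y : Stage R T) : Prop where
  mem : r ∈ x.left
  least : ∀ w ∈ x.left, code r.pos ≤ code w.pos
  contracts : r.Contracts x.term y.term
  left_eq : y.left = residuals r x.left

theorem Stage.exists_step (hR : WeaklyOrthogonal R) (x : Stage R T) (hx : x.left.Nonempty) :
    ∃ r y, x.Step r y := by
  obtain ⟨r, hr, hmin⟩ : ∃ r ∈ x.left, ∀ w ∈ x.left, code r.pos ≤ code w.pos := by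
    obtain ⟨r, hr, h⟩ := WellFounded.has_min (measure fun r : Redex S V => code r.pos).wf _ hx
    exact ⟨r, hr, fun w hw => not_lt.1 (h w hw)⟩
  have hl := hR.1 _ (x.rule_mem r hr)
  have hm := x.isMatch r hr
  obtain ⟨θ, N, h1, h2⟩ := hm.exists_contraction hl
  have hc := contr_of_isReplaceAt h1 h2
  refine ⟨r, ⟨N, residuals r x.left, nonOverlapping_residuals x.nonOverlapping hr hl, ?_,
    matches_residuals x.nonOverlapping hr hc x.isMatch, ?_⟩, hr, hmin, ⟨θ, h1, h2⟩, rfl⟩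
  · rintro w' ⟨w, hw, hrule, -⟩
    rw [hrule]
    exact x.rule_mem w hw
  · intro q a ha
    refine (x.dev q a ha).to_residuals x.nonOverlapping hr hl hm hc ?_
    rw [List.prefix_nil]
    exact (em _).symm.imp id Eq.symm

/-- All redexes of the stage sit at positions with code at least `k`. -/
def Stage.Cleared (x : Stage R T) (k : ℕ) : Prop := ∀ w ∈ x.left, k ≤ code w.pos

theorem Stage.Step.cleared {x y : Stage R T} {r : Redex S V} (h : x.Step r y) {k : ℕ}
    (hk : x.Cleared k) : y.Cleared k := by
  intro w hw
  rw [h.left_eq] at hw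
  by_cases hp : r.pos <+: w.pos
  · exact (hk r h.mem).trans (code_le_of_prefix hp)
  · exact hk w (mem_of_mem_residuals hw hp)

/-- The stages of a construction that never runs out of redexes. -/
structure Run (x : ℕ → Stage R T) (r : ℕ → Redex S V) : Prop where
  step : ∀ n, (x n).Step (r n) (x (n + 1))

variable {x : ℕ → Stage R T} {r : ℕ → Redex S V}

theorem Run.cleared_mono (h : Run x r) {k m n : ℕ} (hmn : m ≤ n) (hk : (x m).Cleared k) :
    (x n).Cleared k := by
  induction n, hmn using Nat.le_induction with
  | base => exact hk
  | succ n _ ih => exact (h.step n).cleared ih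

/-- Once all smaller codes are cleared, a redex at `p` is contracted immediately. Each collapsing
contraction shortens the chain of collapsing redexes at `p`, so `p` is cleared in the end. -/
theorem Run.cleared_succ (h : Run x r) (hR : WeaklyOrthogonal R) {p : Pos} (c : ℕ) :
    ∀ m, (x m).Cleared (code p) → Collapses (x m).left c p → ∃ n, (x n).Cleared (code p + 1) := by
  have hstep : ∀ m, (x m).Cleared (code p) → (∀ w ∈ (x m).left, w.pos ≠ p) ∨ (r m).pos = p := by
    intro m hm
    by_cases hno : ∀ w ∈ (x m).left, w.pos ≠ p
    · exact Or.inl hno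
    · right
      push Not at hno
      obtain ⟨w, hw, rfl⟩ := hno
      exact code_injective (le_antisymm ((h.step m).least w hw) (hm _ (h.step m).mem))
  have hdone : ∀ m, (x m).Cleared (code p) → (∀ w ∈ (x m).left, w.pos ≠ p) →
      (x m).Cleared (code p + 1) := by
    intro m hm hno w hw
    exact lt_of_le_of_ne (hm w hw) fun h' => hno w hw (code_injective h').symm
  induction c with
  | zero =>
    intro m hm hc
    rcases hstep m hm with hno | hp
    · exact ⟨m, hdone m hm hno⟩
    · refine ⟨m + 1, hdone _ ((h.step m).cleared hm) fun w' hw' hwp => ?_⟩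
      rw [(h.step m).left_eq] at hw'
      cases hc with
      | last hc =>
        obtain ⟨w, hw, y, o, o', q, -, -, ho', -, h4⟩ :=
          exists_of_mem_residuals hw' (by rw [hwp, hp])
        have : o' = [] := by
          rw [hwp, hp] at h4
          have := congrArg List.length h4
          simp at this
          exact this.1
        subst this
        exact hc _ (h.step m).mem hp y ho'
  | succ c ih =>
    intro m hm hc
    rcases hstep m hm with hno | hp
    · exact ⟨m, hdone m hm hno⟩
    · cases hc with
      | next u hu hup y o ho hx hc =>
        have hur : u = r m := (x m).nonOverlapping _ hu _ (h.step m).mem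
          (Redex.overlap_of_pos_eq (hup.trans hp.symm))
        subst hur
        refine ih (m + 1) ((h.step m).cleared hm) ?_
        rw [(h.step m).left_eq]
        have := hc.residuals (hR.1 _ ((x m).rule_mem _ hu)) ho hx (r := []) (by simp [hp])
        simpa [hp] using this

theorem Run.exists_cleared (h : Run x r) (hR : WeaklyOrthogonal R) (k : ℕ) :
    ∃ n, (x n).Cleared k := by
  induction k with
  | zero => exact ⟨0, fun w _ => Nat.zero_le _⟩
  | succ k ih =>
    obtain ⟨m, hm⟩ := ih
    by_cases hno : ∃ w ∈ (x m).left, code w.pos = k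
    · obtain ⟨w, hw, rfl⟩ := hno
      have hpre : ∀ k, k <+: w.pos → k ≠ w.pos → ∀ u ∈ (x m).left, u.pos ≠ k := by
        rintro k hk hne u hu rfl
        exact absurd (hm u hu) (not_le.2 (code_lt_of_prefix hk hne))
      have hT := (x m).dev.ne_none hpre ((x m).isMatch w hw).pos_ne_none
      obtain ⟨a, ha⟩ := Option.ne_none_iff_exists'.1 hT
      obtain ⟨c, hc⟩ := ((x m).dev.eval_at hpre ha).exists_collapses (x m).nonOverlapping rfl
      exact h.cleared_succ hR c m hm hc
    · push Not at hno
      exact ⟨m, fun w hw => lt_of_le_of_ne (hm w hw) (hno w hw).symm⟩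

/-- Eventually all redexes that sit at positions of the result are deep. -/
theorem Run.exists_deep (h : Run x r) (hR : WeaklyOrthogonal R) (d : ℕ) :
    ∃ n, ∀ m, n ≤ m → ∀ w ∈ (x m).left, T.sym w.pos ≠ none → d < w.pos.length := by
  obtain ⟨k, hk⟩ := ((finite_positions T d).image code).bddAbove
  obtain ⟨n, hn⟩ := h.exists_cleared hR (k + 1)
  refine ⟨n, fun m hm w hw hT => ?_⟩
  by_contra hd
  have h1 : code w.pos ≤ k := hk ⟨w.pos, ⟨hT, not_lt.1 hd⟩, rfl⟩
  have h2 := h.cleared_mono hm hn w hw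
  omega

theorem Run.step_position (h : Run x r) (n : ℕ) : T.sym (r n).pos ≠ none := by
  refine (x n).dev.ne_none (fun k hk hne u hu hup => ?_)
    ((x n).isMatch _ (h.step n).mem).pos_ne_none
  subst hup
  exact absurd ((h.step n).least u hu) (not_le.2 (code_lt_of_prefix hk hne))

end Construction

open Classical in
/-- Extends a sequence to all ordinals by a constant value from `ω` on. -/
noncomputable def extend {α : Type*} (f : ℕ → α) (c : α) (β : Ordinal.{0}) : α :=
  if h : ∃ n : ℕ, β = n then f h.choose else c

theorem extend_nat {α : Type*} (f : ℕ → α) (c : α) (n : ℕ) : extend f c (n : Ordinal.{0}) = f n := by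
  have h : ∃ m : ℕ, (n : Ordinal.{0}) = m := ⟨n, rfl⟩
  rw [extend, dif_pos h]
  congr 1
  exact_mod_cast h.choose_spec.symm

theorem extend_omega {α : Type*} (f : ℕ → α) (c : α) : extend f c Ordinal.omega0.{0} = c := by
  rw [extend, dif_neg]
  rintro ⟨n, hn⟩
  exact (Ordinal.natCast_lt_omega0 n).ne hn.symm

theorem not_isSuccLimit_nat (n : ℕ) : ¬ IsSuccLimit (n : Ordinal.{0}) := by
  intro h
  exact absurd (Ordinal.omega0_le_of_isSuccLimit h) (not_le.2 (Ordinal.natCast_lt_omega0 n))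

/-- A set of redexes whose evaluation is `T` has a development with result `T`, of length at most
`ω`. The redex `r₀` serves as the irrelevant value of the steps beyond the length. -/
theorem exists_development {R : Set (Rule S V)} (hR : WeaklyOrthogonal R) {t T : ITerm S V}
    {U : Set (Redex S V)} (hin : ∀ u ∈ U, u.In R t) (hU : NonOverlapping U) (hdev : Dev t U T)
    (r₀ : Redex S V) :
    ∃ σ : Development R t U, σ.target = T := by
  classical
  have hmat : ∀ u ∈ U, u.Matches t := by
    intro u hu
    obtain ⟨-, θ, hθ⟩ := hin u hu
    exact matches_of_isSubtermAt hθ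
  let x₀ : Stage R T := ⟨t, U, hU, fun w hw => (hin w hw).1, hmat, hdev⟩
  -- Once the redexes are exhausted, the sequences below are continued with irrelevant values.
  let next : Stage R T → Stage R T := fun x =>
    if h : x.left.Nonempty then (x.exists_step hR h).choose_spec.choose else x
  have hnext : ∀ x : Stage R T, x.left.Nonempty → ∃ r, x.Step r (next x) := by
    intro x hx
    refine ⟨(x.exists_step hR hx).choose, ?_⟩
    simp only [next, dif_pos hx]
    exact (x.exists_step hR hx).choose_spec.choose_spec
  let x : ℕ → Stage R T := fun n => next^[n] x₀
  have hx0 : x 0 = x₀ := rfl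
  have hxs : ∀ n, x (n + 1) = next (x n) := fun n => Function.iterate_succ_apply' _ _ _
  have hstep : ∀ n, ∃ r : Redex S V, (x n).left.Nonempty → (x n).Step r (x (n + 1)) := by
    intro n
    by_cases hn : (x n).left.Nonempty
    · obtain ⟨r, hr⟩ := hnext _ hn
      exact ⟨r, fun _ => hxs n ▸ hr⟩
    · exact ⟨r₀, fun h => absurd h hn⟩
  choose r hr using hstep
  have hsucc : ∀ n : ℕ, Order.succ (n : Ordinal.{0}) = ((n + 1 : ℕ) : Ordinal.{0}) := by
    intro n
    rw [Order.succ_eq_add_one]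
    push_cast
    rfl
  by_cases hfin : ∃ n, (x n).left = ∅
  · have hN := Nat.find_spec hfin
    have hlt : ∀ n < Nat.find hfin, (x n).left.Nonempty := fun n hn =>
      Set.nonempty_iff_ne_empty.2 (Nat.find_min hfin hn)
    have hnat : ∀ β < (Nat.find hfin : Ordinal.{0}), ∃ n : ℕ, β = n ∧ n < Nat.find hfin := by
      intro β hβ
      obtain ⟨n, rfl⟩ := Ordinal.lt_omega0.1 (hβ.trans (Ordinal.natCast_lt_omega0 _))
      exact ⟨n, rfl, by exact_mod_cast hβ⟩
    have hlim : ∀ l ≤ (Nat.find hfin : Ordinal.{0}), ¬ IsSuccLimit l := by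
      intro l hl
      obtain ⟨n, rfl⟩ := Ordinal.lt_omega0.1 (hl.trans_lt (Ordinal.natCast_lt_omega0 _))
      exact not_isSuccLimit_nat n
    refine ⟨{
      isRedex := hin
      nonOverlapping := hU
      length := (Nat.find hfin : Ordinal.{0})
      term := extend (fun n => (x n).term) T
      left := extend (fun n => (x n).left) ∅
      step := extend r r₀
      term_zero := extend_nat (fun n => (x n).term) T 0
      left_zero := extend_nat (fun n => (x n).left) ∅ 0
      step_mem := ?_
      contracts := ?_
      left_succ := ?_
      strong := fun l hl h => absurd h (hlim l hl)
      term_limit := fun l hl h => absurd h (hlim l hl)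
      left_limit := fun l hl h => absurd h (hlim l hl)
      complete := by rw [extend_nat, hN] }, ?_⟩
    · intro β hβ
      obtain ⟨n, rfl, hn⟩ := hnat β hβ
      rw [extend_nat, extend_nat]
      exact (hr n (hlt n hn)).mem
    · intro β hβ
      obtain ⟨n, rfl, hn⟩ := hnat β hβ
      rw [hsucc, extend_nat, extend_nat, extend_nat]
      exact (hr n (hlt n hn)).contracts
    · intro β hβ
      obtain ⟨n, rfl, hn⟩ := hnat β hβ
      rw [hsucc, extend_nat, extend_nat, extend_nat]
      exact (hr n (hlt n hn)).left_eq
    · refine (extend_nat (fun n => (x n).term) T (Nat.find hfin)).trans ?_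
      refine (eq_of_le fun q a ha => ?_).symm
      have := (x (Nat.find hfin)).dev q a ha
      rw [hN, eval_empty] at this
      exact this
  · push Not at hfin
    have hne : ∀ n, (x n).left.Nonempty := hfin
    have hrun : Run x r := ⟨fun n => hr n (hne n)⟩
    have hnat : ∀ β < Ordinal.omega0.{0}, ∃ n : ℕ, β = n := fun β hβ => Ordinal.lt_omega0.1 hβ
    have hlim : ∀ l ≤ Ordinal.omega0.{0}, IsSuccLimit l → l = Ordinal.omega0.{0} := fun l hl h =>
      le_antisymm hl (Ordinal.omega0_le_of_isSuccLimit h)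
    -- A statement about all late ordinals below `ω` is one about all large natural numbers.
    have hev : ∀ {P : Ordinal.{0} → Prop}, (∃ n : ℕ, ∀ m : ℕ, n ≤ m → P m) →
        ∃ β < Ordinal.omega0.{0}, ∀ γ, β ≤ γ → γ < Ordinal.omega0.{0} → P γ := by
      rintro P ⟨n, hn⟩
      refine ⟨n, Ordinal.natCast_lt_omega0 n, fun γ h1 h2 => ?_⟩
      obtain ⟨m, rfl⟩ := hnat γ h2
      exact hn m (by exact_mod_cast h1)
    refine ⟨{
      isRedex := hin
      nonOverlapping := hU
      length := Ordinal.omega0.{0}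
      term := extend (fun n => (x n).term) T
      left := extend (fun n => (x n).left) ∅
      step := extend r r₀
      term_zero := extend_nat (fun n => (x n).term) T 0
      left_zero := extend_nat (fun n => (x n).left) ∅ 0
      step_mem := ?_
      contracts := ?_
      left_succ := ?_
      strong := ?_
      term_limit := ?_
      left_limit := ?_
      complete := extend_omega _ _ }, extend_omega (fun n => (x n).term) T⟩
    · intro β hβ
      obtain ⟨n, rfl⟩ := hnat β hβ
      rw [extend_nat, extend_nat]
      exact (hr n (hne n)).mem
    · intro β hβ
      obtain ⟨n, rfl⟩ := hnat β hβ
      rw [hsucc, extend_nat, extend_nat, extend_nat]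
      exact (hr n (hne n)).contracts
    · intro β hβ
      obtain ⟨n, rfl⟩ := hnat β hβ
      rw [hsucc, extend_nat, extend_nat, extend_nat]
      exact (hr n (hne n)).left_eq
    · intro l hl h d
      rw [hlim l hl h]
      refine hev ?_
      obtain ⟨n, hn⟩ := hrun.exists_deep hR d
      refine ⟨n, fun m hm => ?_⟩
      rw [extend_nat]
      exact hn m hm _ (hr m (hne m)).mem (hrun.step_position m)
    · intro l hl h d
      rw [hlim l hl h]
      refine hev ?_
      obtain ⟨n, hn⟩ := hrun.exists_deep hR d
      refine ⟨n, fun m hm p hp => ?_⟩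
      rw [extend_nat, extend_omega]
      exact (x m).dev.sym_eq ((x m).dev.no_shallow (x m).isMatch (hn m hm) hp)
    · intro l hl h w
      rw [hlim l hl h, extend_omega]
      refine ⟨fun h => h.elim, ?_⟩
      rintro ⟨β, hβ, hw⟩
      exfalso
      obtain ⟨n, rfl⟩ := hnat β hβ
      obtain ⟨m, hm⟩ := hrun.exists_cleared hR (code w.pos + 1)
      have h1 := hw (max n m : ℕ) (by exact_mod_cast le_max_left n m)
        (Ordinal.natCast_lt_omega0 _)
      rw [extend_nat] at h1
      have h2 := hrun.cleared_mono (le_max_right n m) hm w h1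
      omega

/-! ### Truncation of a term to a cluster of positions -/

open Classical in
/-- The term `t` cut off where paths from the root leave `E` or meet a variable. Each subterm cut
off becomes a variable, named by its position. -/
noncomputable def ITerm.truncate (t : ITerm S W) (E : Set Pos) : ITerm S Pos where
  sym p :=
    if ∀ k, k <+: p → k ≠ p → k ∈ E then
      match t.sym p with
      | none => none
      | some (Sum.inl f) => if p ∈ E then some (Sum.inl f) else some (Sum.inr p)
      | some (Sum.inr _) => some (Sum.inr p)
    else none
  root := by
    have h : ∀ k, k <+: ([] : Pos) → k ≠ [] → k ∈ E := by
      intro k hk hne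
      exact absurd (List.prefix_nil.1 hk) hne
    rw [if_pos h]
    rcases hr : t.sym [] with _ | (f | x)
    · exact absurd hr t.root
    · dsimp only
      split_ifs <;> simp
    · simp
  child p i := by
    have h1 : (∀ k, k <+: p ++ [i] → k ≠ p ++ [i] → k ∈ E) ↔
        (∀ k, k <+: p → k ≠ p → k ∈ E) ∧ p ∈ E := by
      constructor
      · intro h
        refine ⟨fun k hk _ => h k (hk.trans (List.prefix_append _ _)) ?_,
          h p (List.prefix_append _ _) (by simp)⟩
        rintro rfl
        have := hk.length_le
        simp at this
      · rintro ⟨h, hp⟩ k hk hne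
        rcases List.prefix_concat_iff.1 hk with h2 | h2
        · exact absurd h2 hne
        · by_cases hkp : k = p
          · rwa [hkp]
          · exact h k h2 hkp
    have h2 : ∀ q, (match t.sym q with
      | none => none
      | some (Sum.inl f) => if q ∈ E then some (Sum.inl f) else some (Sum.inr q)
      | some (Sum.inr _) => some (Sum.inr q) : Option (S.Sym ⊕ Pos)) ≠ none ↔
        t.sym q ≠ none := by
      intro q
      rcases hq : t.sym q with _ | (f | x)
      · simp
      · dsimp only
        split_ifs <;> simp
      · simp
    rw [h1]
    by_cases hp : ∀ k, k <+: p → k ≠ p → k ∈ E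
    · rw [if_pos hp]
      by_cases hpE : p ∈ E
      · rw [if_pos ⟨hp, hpE⟩, h2, t.child]
        rcases hq : t.sym p with _ | (f | x) <;> simp [hpE]
      · rw [if_neg fun h => hpE h.2]
        rcases hq : t.sym p with _ | (f | x) <;> simp [hpE]
    · rw [if_neg hp, if_neg fun h => hp h.1]
      simp

/-- `D` is a connected set of function positions of `t` with topmost position `c`. -/
structure IsCluster (t : ITerm S W) (c : Pos) (D : Set Pos) : Prop where
  root_mem : c ∈ D
  root_prefix : ∀ p ∈ D, c <+: p
  closed : ∀ p ∈ D, ∀ k, c <+: k → k <+: p → k ∈ D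
  isFun : ∀ p ∈ D, ∃ f, t.sym p = some (Sum.inl f)

/-- The term `t` restricted to a cluster and the positions above it. -/
noncomputable def clusterTerm (t : ITerm S W) (c : Pos) (D : Set Pos) : ITerm S Pos :=
  t.truncate (D ∪ {p | p <+: c ∧ p ≠ c})

namespace IsCluster

variable {t : ITerm S W} {c : Pos} {D : Set Pos}

theorem prefix_mem (h : IsCluster t c D) {p k : Pos} (hp : p ∈ D) (hk : k <+: p) :
    k ∈ D ∪ {p | p <+: c ∧ p ≠ c} := by
  rcases List.prefix_or_prefix_of_prefix (h.root_prefix p hp) hk with h1 | h1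
  · exact Or.inl (h.closed p hp k h1 hk)
  · by_cases hkc : k = c
    · exact Or.inl (hkc ▸ h.root_mem)
    · exact Or.inr ⟨h1, hkc⟩

theorem sym_fun (h : IsCluster t c D) {p : Pos} {f : S.Sym} (hp : p ∈ D)
    (hf : t.sym p = some (Sum.inl f)) : (clusterTerm t c D).sym p = some (Sum.inl f) := by
  have h1 : ∀ k, k <+: p → k ≠ p → k ∈ D ∪ {p | p <+: c ∧ p ≠ c} :=
    fun k hk _ => h.prefix_mem hp hk
  simp only [clusterTerm, ITerm.truncate]
  rw [if_pos h1, hf]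
  exact if_pos (Or.inl hp)

theorem sym_boundary (h : IsCluster t c D) {p : Pos} {i : ℕ} (hp : p ∈ D)
    (hpi : p ++ [i] ∉ D) (hs : t.sym (p ++ [i]) ≠ none) :
    (clusterTerm t c D).sym (p ++ [i]) = some (Sum.inr (p ++ [i])) := by
  have h1 : ∀ k, k <+: p ++ [i] → k ≠ p ++ [i] → k ∈ D ∪ {p | p <+: c ∧ p ≠ c} := by
    intro k hk hne
    rcases List.prefix_concat_iff.1 hk with h2 | h2
    · exact absurd h2 hne
    · exact h.prefix_mem hp h2
  have h2 : p ++ [i] ∉ D ∪ {p | p <+: c ∧ p ≠ c} := by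
    rintro (h2 | ⟨h2, -⟩)
    · exact hpi h2
    · have := ((h.root_prefix p hp).length_le.trans' h2.length_le)
      simp at this
  simp only [clusterTerm, ITerm.truncate]
  rw [if_pos h1]
  rcases hq : t.sym (p ++ [i]) with _ | (f | x)
  · exact absurd hq hs
  · exact if_neg h2
  · rfl

theorem mem_of_sym_fun {p : Pos} {f : S.Sym} (hc : c <+: p)
    (hf : (clusterTerm t c D).sym p = some (Sum.inl f)) : p ∈ D ∧ t.sym p = some (Sum.inl f) := by
  simp only [clusterTerm, ITerm.truncate] at hf
  split_ifs at hf with h1 h2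
  · rcases hq : t.sym p with _ | (g | x)
    · simp [hq] at hf
    · rw [hq] at hf
      have hgf : g = f := by simpa using hf
      refine ⟨?_, by rw [hgf]⟩
      rcases h2 with h2 | ⟨h2, h3⟩
      · exact h2
      · exact absurd (h2.eq_of_length_le hc.length_le) h3
    · simp [hq] at hf
  · rcases hq : t.sym p with _ | (g | x) <;> simp [hq] at hf

theorem eq_of_sym_var {p b : Pos} (hf : (clusterTerm t c D).sym p = some (Sum.inr b)) :
    b = p := by
  simp only [clusterTerm, ITerm.truncate] at hf
  split_ifs at hf <;> rcases hq : t.sym p with _ | (g | x) <;> rw [hq] at hf <;>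
    simp at hf <;> exact hf.symm

theorem matches_clusterTerm (h : IsCluster t c D) {u : Redex S V} (hu : u.Matches t)
    (hD : u.pattern ⊆ D) : u.Matches (clusterTerm t c D) := by
  intro q f hf
  exact h.sym_fun (hD ⟨q, f, hf, rfl⟩) (hu q f hf)

end IsCluster

/-! ### Exchanging redexes inside disjoint clusters -/

section Exchange

variable {ι : Type*} {t : ITerm S W} {c : ι → Pos} {D : ι → Set Pos} {P P' : ι → Set (Redex S V)}

/-- An evaluation in a truncated term is an initial part of an evaluation in the whole term. -/
theorem Eval.of_clusterTerm (hdisj : ∀ i j p, p ∈ D i → p ∈ D j → i = j)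
    (hP' : ∀ i, ∀ u ∈ P' i, u.pos ∈ D i) {i : ι} {p q : Pos}
    {z : S.Sym ⊕ Pos} (h : Eval (clusterTerm t (c i) (D i)) (P' i) p q z) (hc : c i <+: p) :
    (∀ f, z = Sum.inl f → Eval t (⋃ i, P' i) p q (Sum.inl f)) ∧
      ∀ b, z = Sum.inr b → ∀ q' a, Eval t (⋃ i, P' i) b q' a →
        Eval t (⋃ i, P' i) p (q ++ q') a := by
  have hno : ∀ p ∈ D i, (∀ u ∈ P' i, u.pos ≠ p) → ∀ u ∈ ⋃ i, P' i, u.pos ≠ p := by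
    intro p hp hno u hu hup
    obtain ⟨j, hj⟩ := Set.mem_iUnion.1 hu
    have : j = i := hdisj j i p (hup ▸ hP' j u hj) hp
    subst this
    exact hno u hj hup
  induction h with
  | @here p z hp ha =>
    refine ⟨?_, ?_⟩
    · rintro f rfl
      obtain ⟨h1, h2⟩ := IsCluster.mem_of_sym_fun hc ha
      exact Eval.here (hno p h1 hp) h2
    · rintro b rfl q' a h
      rw [IsCluster.eq_of_sym_var ha] at h
      exact h
  | @down p j q z f hp hf hi h ih =>
    obtain ⟨h1, h2⟩ := IsCluster.mem_of_sym_fun hc hf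
    obtain ⟨ih1, ih2⟩ := ih (hc.trans (List.prefix_append _ _))
    exact ⟨fun g hg => Eval.down (hno p h1 hp) h2 hi (ih1 g hg),
      fun b hb q' a h => Eval.down (hno p h1 hp) h2 hi (ih2 b hb q' a h)⟩
  | @emit p q f u hu hp hf =>
    refine ⟨?_, fun b hb => by cases hb⟩
    rintro g hg
    cases hg
    exact Eval.emit u (Set.mem_iUnion.2 ⟨i, hu⟩) hp hf
  | @jump p q z u hu hp x o o' r ho ho' hq h ih =>
    obtain ⟨ih1, ih2⟩ := ih (hc.trans (List.prefix_append _ _))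
    have hu' : u ∈ ⋃ i, P' i := Set.mem_iUnion.2 ⟨i, hu⟩
    exact ⟨fun g hg => Eval.jump u hu' hp x o o' r ho ho' hq (ih1 g hg),
      fun b hb q' a h => Eval.jump u hu' hp x o o' (r ++ q') ho ho' (by simp [hq])
        (ih2 b hb q' a h)⟩

/-- If in each of a family of disjoint clusters the redexes `P i` are replaced by redexes `P' i` in
such a way that, inside the truncated terms, evaluations from the roots are preserved, then
evaluations in the whole term are preserved at all positions that do not lie in a cluster, except
possibly as its root. An evaluation that enters a cluster at its root either ends inside or leaves
through a position of the boundary; the truncated term records which one. -/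
theorem Eval.exchange (hD : ∀ i, IsCluster t (c i) (D i))
    (hdisj : ∀ i j p, p ∈ D i → p ∈ D j → i = j) (hP : ∀ i, ∀ u ∈ P i, u.pattern ⊆ D i)
    (hm : ∀ i, ∀ u ∈ P i, u.Matches t) (hU : NonOverlapping (⋃ i, P i))
    (hP' : ∀ i, ∀ u ∈ P' i, u.pos ∈ D i)
    (hex : ∀ i q a, Eval (clusterTerm t (c i) (D i)) (P i) (c i) q a →
      Eval (clusterTerm t (c i) (D i)) (P' i) (c i) q a)
    {p q : Pos} {a : S.Sym ⊕ W} (h : Eval t (⋃ i, P i) p q a) (hp : ∀ i, p ∈ D i → p = c i) :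
    Eval t (⋃ i, P' i) p q a := by
  have hpos : ∀ i, ∀ u ∈ P i, u.pos ∈ D i := fun i u hu => hP i u hu u.pos_mem_pattern
  -- Clusters are entered at their roots only.
  have hentry : ∀ {p : Pos} {i : ι} {k : ℕ}, p ∈ D i → p ++ [k] ∉ D i →
      ∀ j, p ++ [k] ∈ D j → p ++ [k] = c j := by
    intro p i k hpi hpk j hj
    rcases List.prefix_concat_iff.1 ((hD j).root_prefix _ hj) with h1 | h1
    · exact h1.symm
    · have := hdisj i j p hpi ((hD j).closed _ hj _ h1 (List.prefix_append _ _))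
      subst this
      exact absurd hj hpk
  have key : ((∀ i, p ∈ D i → p = c i) → Eval t (⋃ i, P' i) p q a) ∧
      ∀ i, p ∈ D i → (∀ u ∈ P i, p ∈ u.pattern → p = u.pos) →
        (∃ f, a = Sum.inl f ∧ Eval (clusterTerm t (c i) (D i)) (P i) p q (Sum.inl f)) ∨
        ∃ q₁ q₂ b, q = q₁ ++ q₂ ∧ Eval (clusterTerm t (c i) (D i)) (P i) p q₁ (Sum.inr b) ∧
          Eval t (⋃ i, P' i) b q₂ a := by
    clear hp
    -- At the root of a cluster, the second clause yields the first one.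
    have hroot : ∀ {p q : Pos} {a : S.Sym ⊕ W} {i : ι},
        (∀ i, p ∈ D i → (∀ u ∈ P i, p ∈ u.pattern → p = u.pos) →
          (∃ f, a = Sum.inl f ∧ Eval (clusterTerm t (c i) (D i)) (P i) p q (Sum.inl f)) ∨
          ∃ q₁ q₂ b, q = q₁ ++ q₂ ∧ Eval (clusterTerm t (c i) (D i)) (P i) p q₁ (Sum.inr b) ∧
            Eval t (⋃ i, P' i) b q₂ a) →
        p ∈ D i → p = c i → Eval t (⋃ i, P' i) p q a := by
      intro p q a i h hpi hpc
      subst hpc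
      have hval : ∀ u ∈ P i, c i ∈ u.pattern → c i = u.pos := fun u hu hcu =>
        ((hD i).root_prefix _ (hpos i u hu)).eq_of_length_le
          (Redex.pos_prefix_of_mem_pattern hcu).length_le
      rcases h i hpi hval with ⟨f, rfl, h1⟩ | ⟨q₁, q₂, b, rfl, h1, h2⟩
      · exact (Eval.of_clusterTerm hdisj hP' (hex i _ _ h1) List.prefix_rfl).1 f rfl
      · exact (Eval.of_clusterTerm hdisj hP' (hex i _ _ h1) List.prefix_rfl).2 b rfl _ _ h2
    -- On leaving the cluster the evaluation in the truncated term ends at a variable.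
    have hleave : ∀ {p : Pos} {i : ι} {k : ℕ}, p ∈ D i → p ++ [k] ∉ D i → t.sym (p ++ [k]) ≠ none →
        Eval (clusterTerm t (c i) (D i)) (P i) (p ++ [k]) [] (Sum.inr (p ++ [k])) := by
      intro p i k hpi hpk hs
      refine Eval.here (fun u hu hup => hpk (hup ▸ hpos i u hu)) ((hD i).sym_boundary hpi hpk hs)
    induction h with
    | @here p a hp ha =>
      have h2 : ∀ i, p ∈ D i → (∀ u ∈ P i, p ∈ u.pattern → p = u.pos) →
          (∃ f, a = Sum.inl f ∧ Eval (clusterTerm t (c i) (D i)) (P i) p [] (Sum.inl f)) ∨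
          ∃ q₁ q₂ b, [] = q₁ ++ q₂ ∧ Eval (clusterTerm t (c i) (D i)) (P i) p q₁ (Sum.inr b) ∧
            Eval t (⋃ i, P' i) b q₂ a := by
        intro i hpi hval
        left
        obtain ⟨f, hf⟩ := (hD i).isFun p hpi
        rw [hf] at ha
        cases ha
        exact ⟨f, rfl, Eval.here (fun u hu => hp u (Set.mem_iUnion.2 ⟨i, hu⟩))
          ((hD i).sym_fun hpi hf)⟩
      refine ⟨fun hs => ?_, h2⟩
      by_cases hin : ∃ i, p ∈ D i
      · obtain ⟨i, hi⟩ := hin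
        exact hroot h2 hi (hs i hi)
      · refine Eval.here (fun u hu hup => hin ?_) ha
        obtain ⟨i, hi⟩ := Set.mem_iUnion.1 hu
        exact ⟨i, hup ▸ hP' i u hi⟩
    | @down p k q a f hp hf hk h ih =>
      obtain ⟨ih1, ih2⟩ := ih
      have h2 : ∀ i, p ∈ D i → (∀ u ∈ P i, p ∈ u.pattern → p = u.pos) →
          (∃ f, a = Sum.inl f ∧ Eval (clusterTerm t (c i) (D i)) (P i) p (k :: q) (Sum.inl f)) ∨
          ∃ q₁ q₂ b, k :: q = q₁ ++ q₂ ∧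
            Eval (clusterTerm t (c i) (D i)) (P i) p q₁ (Sum.inr b) ∧
            Eval t (⋃ i, P' i) b q₂ a := by
        intro i hpi hval
        have hp' : ∀ u ∈ P i, u.pos ≠ p := fun u hu => hp u (Set.mem_iUnion.2 ⟨i, hu⟩)
        have hf' := (hD i).sym_fun hpi hf
        by_cases hpk : p ++ [k] ∈ D i
        · have hval' : ∀ u ∈ P i, p ++ [k] ∈ u.pattern → p ++ [k] = u.pos := by
            intro u hu hpu
            rcases List.prefix_concat_iff.1 (Redex.pos_prefix_of_mem_pattern hpu) with h1 | h1
            · exact h1.symm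
            · exact absurd (hval u hu (Redex.mem_pattern_of_prefix hpu h1
                (List.prefix_append _ _))).symm (hp' u hu)
          rcases ih2 i hpk hval' with ⟨g, rfl, h1⟩ | ⟨q₁, q₂, b, rfl, h1, h3⟩
          · exact Or.inl ⟨g, rfl, Eval.down hp' hf' hk h1⟩
          · exact Or.inr ⟨k :: q₁, q₂, b, rfl, Eval.down hp' hf' hk h1, h3⟩
        · exact Or.inr ⟨[k], q, p ++ [k], rfl,
            Eval.down hp' hf' hk (hleave hpi hpk (child_ne_none hf hk)),
            ih1 (hentry hpi hpk)⟩
      refine ⟨fun hs => ?_, h2⟩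
      by_cases hin : ∃ i, p ∈ D i
      · obtain ⟨i, hi⟩ := hin
        exact hroot h2 hi (hs i hi)
      · refine Eval.down (fun u hu hup => hin ?_) hf hk (ih1 fun j hj => ?_)
        · obtain ⟨i, hi⟩ := Set.mem_iUnion.1 hu
          exact ⟨i, hup ▸ hP' i u hi⟩
        · rcases List.prefix_concat_iff.1 ((hD j).root_prefix _ hj) with h1 | h1
          · exact h1.symm
          · exact absurd ⟨j, (hD j).closed _ hj _ h1 (List.prefix_append _ _)⟩ hin
    | @emit p q f u hu hp hf =>
      obtain ⟨j, hj⟩ := Set.mem_iUnion.1 hu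
      have hpj : p ∈ D j := hp ▸ hpos j u hj
      have h2 : ∀ i, p ∈ D i → (∀ u ∈ P i, p ∈ u.pattern → p = u.pos) →
          (∃ g, (Sum.inl f : S.Sym ⊕ W) = Sum.inl g ∧
            Eval (clusterTerm t (c i) (D i)) (P i) p q (Sum.inl g)) ∨
          ∃ q₁ q₂ b, q = q₁ ++ q₂ ∧ Eval (clusterTerm t (c i) (D i)) (P i) p q₁ (Sum.inr b) ∧
            Eval t (⋃ i, P' i) b q₂ (Sum.inl f) := by
        intro i hpi hval
        have := hdisj i j p hpi hpj
        subst this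
        exact Or.inl ⟨f, rfl, Eval.emit u hj hp hf⟩
      exact ⟨fun hs => hroot h2 hpj (hs j hpj), h2⟩
    | @jump p q a u hu hp x o o' r ho ho' hq h ih =>
      obtain ⟨ih1, ih2⟩ := ih
      obtain ⟨j, hj⟩ := Set.mem_iUnion.1 hu
      have hpj : p ∈ D j := hp ▸ hpos j u hj
      have h2 : ∀ i, p ∈ D i → (∀ u ∈ P i, p ∈ u.pattern → p = u.pos) →
          (∃ f, a = Sum.inl f ∧ Eval (clusterTerm t (c i) (D i)) (P i) p q (Sum.inl f)) ∨
          ∃ q₁ q₂ b, q = q₁ ++ q₂ ∧ Eval (clusterTerm t (c i) (D i)) (P i) p q₁ (Sum.inr b) ∧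
            Eval t (⋃ i, P' i) b q₂ a := by
        intro i hpi hval
        have := hdisj i j p hpi hpj
        subst this
        -- The position above the exit lies in the pattern of `u`.
        obtain ⟨k, l, rfl⟩ : ∃ k l, o = k ++ [l] := by
          rcases List.eq_nil_or_concat o with rfl | ⟨k, l, rfl⟩
          · exact absurd rfl (u.lhs_var_ne_nil ho)
          · exact ⟨k, l, by simp⟩
        obtain ⟨g, hg⟩ := exists_fun_of_append (t := u.rule.lhs) (p := k) (q := [l])
          (by rw [ho]; simp) (by simp)
        have hku : p ++ k ∈ u.pattern := ⟨k, g, hg, by rw [hp]⟩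
        have hkD : p ++ k ∈ D i := hP i u hj hku
        rw [← List.append_assoc] at ih1 ih2
        by_cases hkl : p ++ k ++ [l] ∈ D i
        · have hval' : ∀ u' ∈ P i, p ++ k ++ [l] ∈ u'.pattern → p ++ k ++ [l] = u'.pos := by
            intro u' hu' hpu
            rcases List.prefix_concat_iff.1 (Redex.pos_prefix_of_mem_pattern hpu) with h1 | h1
            · exact h1.symm
            · have h3 := Redex.mem_pattern_of_prefix hpu h1 (List.prefix_append _ _)
              have : u = u' := hU u hu u' (Set.mem_iUnion.2 ⟨i, hu'⟩)
                (Redex.overlap_of_mem hku h3)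
              subst this
              rw [← hp, List.append_assoc, Redex.mem_pattern_append] at hpu
              obtain ⟨g', hg'⟩ := hpu
              rw [ho] at hg'
              cases hg'
          rcases ih2 i hkl hval' with ⟨f, rfl, h1⟩ | ⟨q₁, q₂, b, rfl, h1, h3⟩
          · rw [List.append_assoc] at h1
            exact Or.inl ⟨f, rfl, Eval.jump u hj hp x _ o' r ho ho' hq h1⟩
          · rw [List.append_assoc] at h1
            exact Or.inr ⟨o' ++ q₁, q₂, b, by simp [hq],
              Eval.jump u hj hp x _ o' q₁ ho ho' rfl h1, h3⟩
        · have hs : t.sym (p ++ k ++ [l]) ≠ none := by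
            rw [← hp, List.append_assoc]
            exact (hm i u hj).ne_none (by rw [ho]; simp)
          have h1 := hleave hkD hkl hs
          rw [List.append_assoc p] at h1
          refine Or.inr ⟨o', r, p ++ k ++ [l], hq, ?_, ih1 (hentry hkD hkl)⟩
          refine Eval.jump u hj hp x _ o' [] ho ho' (by simp) ?_
          rw [List.append_assoc p]
          exact h1
      exact ⟨fun hs => hroot h2 hpj (hs j hpj), h2⟩
  exact key.1 hp

end Exchange

/-! ### Replacing a redex by an overlapping one -/

theorem isCluster_pattern {s : ITerm S W} {u : Redex S V} (hu : u.Matches s) :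
    IsCluster s u.pos u.pattern where
  root_mem := u.pos_mem_pattern
  root_prefix _ := Redex.pos_prefix_of_mem_pattern
  closed _ hp _ h1 h2 := Redex.mem_pattern_of_prefix hp h1 h2
  isFun _ := hu.exists_fun

theorem isCluster_union {s : ITerm S W} {u v : Redex S V} (hu : u.Matches s) (hv : v.Matches s)
    (h : v.pos ∈ u.pattern) : IsCluster s u.pos (u.pattern ∪ v.pattern) where
  root_mem := Or.inl u.pos_mem_pattern
  root_prefix p hp := by
    rcases hp with hp | hp
    · exact Redex.pos_prefix_of_mem_pattern hp
    · exact (Redex.pos_prefix_of_mem_pattern h).trans (Redex.pos_prefix_of_mem_pattern hp)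
  closed p hp k h1 h2 := by
    rcases hp with hp | hp
    · exact Or.inl (Redex.mem_pattern_of_prefix hp h1 h2)
    · rcases List.prefix_or_prefix_of_prefix (Redex.pos_prefix_of_mem_pattern hp) h2 with h3 | h3
      · exact Or.inr (Redex.mem_pattern_of_prefix hp h3 h2)
      · exact Or.inl (Redex.mem_pattern_of_prefix h h1 h3)
  isFun p hp := by
    rcases hp with hp | hp
    · exact hu.exists_fun hp
    · exact hv.exists_fun hp

theorem exists_isCluster_union {s : ITerm S W} {u v : Redex S V} (hu : u.Matches s)
    (hv : v.Matches s) (h : u.Overlap v) :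
    ∃ c, (c = u.pos ∨ c = v.pos) ∧ IsCluster s c (u.pattern ∪ v.pattern) := by
  rcases Redex.overlap_iff.1 h with h | h
  · exact ⟨_, Or.inl rfl, isCluster_union hu hv h⟩
  · refine ⟨_, Or.inr rfl, ?_⟩
    rw [Set.union_comm]
    exact isCluster_union hv hu h

/-- If `v` overlaps only `u` among the redexes in `A`, then `u` may be replaced by `v`: contracting
either one has the same effect on the cluster formed by their patterns. -/
theorem Eval.replace {R : Set (Rule S V)} (hR : WeaklyOrthogonal R) {s : ITerm S W}
    {A : Set (Redex S V)} (hA : NonOverlapping A) (hAR : ∀ w ∈ A, w.rule ∈ R)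
    (hAm : ∀ w ∈ A, w.Matches s) {u v : Redex S V} (hu : u ∈ A) (hvR : v.rule ∈ R)
    (hvm : v.Matches s) (huv : u.Overlap v) (honly : ∀ w ∈ A, w.Overlap v → w = u)
    {p q : Pos} {a : S.Sym ⊕ W} (hpA : ∀ w ∈ A, p <+: w.pos) (hpv : p <+: v.pos)
    (h : Eval s A p q a) : Eval s (insert v (A \ {u})) p q a := by
  classical
  let D : {w // w ∈ A} → Set Pos := fun w =>
    if w.1 = u then u.pattern ∪ v.pattern else w.1.pattern
  let P : {w // w ∈ A} → Set (Redex S V) := fun w => {w.1}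
  let P' : {w // w ∈ A} → Set (Redex S V) := fun w => if w.1 = u then {v} else {w.1}
  have hc : ∀ w : {w // w ∈ A}, ∃ c, p <+: c ∧ IsCluster s c (D w) := by
    rintro ⟨w, hw⟩
    by_cases hwu : w = u
    · obtain ⟨c, hc, hcl⟩ := exists_isCluster_union (hAm u hu) hvm huv
      refine ⟨c, ?_, by simpa [D, hwu] using hcl⟩
      rcases hc with rfl | rfl
      · exact hpA u hu
      · exact hpv
    · exact ⟨w.pos, hpA w hw, by simpa [D, hwu] using isCluster_pattern (hAm w hw)⟩
  choose c hpc hcl using hc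
  have hPU : (⋃ w, P w) = A := by
    ext w
    simp [P]
  have hPU' : (⋃ w, P' w) = insert v (A \ {u}) := by
    ext w
    simp only [Set.mem_iUnion, Set.mem_insert_iff, Set.mem_sdiff, Set.mem_singleton_iff]
    constructor
    · rintro ⟨⟨w', hw'⟩, h⟩
      by_cases hwu : w' = u
      · left
        simpa [P', hwu] using h
      · right
        have : w = w' := by simpa [P', hwu] using h
        exact this ▸ ⟨hw', hwu⟩
    · rintro (rfl | ⟨h1, h2⟩)
      · exact ⟨⟨u, hu⟩, by simp [P']⟩
      · exact ⟨⟨w, h1⟩, by simp [P', h2]⟩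
  have hdisj : ∀ i j p, p ∈ D i → p ∈ D j → i = j := by
    rintro ⟨i, hi⟩ ⟨j, hj⟩ z hzi hzj
    apply Subtype.ext
    dsimp only
    by_cases hiu : i = u
    · by_cases hju : j = u
      · rw [hiu, hju]
      · simp only [D, hiu, hju, if_true, if_false] at hzi hzj
        rcases hzi with hzi | hzi
        · exact hiu.trans (hA u hu j hj (Redex.overlap_of_mem hzi hzj))
        · exact absurd (honly j hj (Redex.overlap_of_mem hzj hzi)) hju
    · by_cases hju : j = u
      · simp only [D, hiu, hju, if_true, if_false] at hzi hzj
        rcases hzj with hzj | hzj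
        · exact (hA i hi u hu (Redex.overlap_of_mem hzi hzj)).trans hju.symm
        · exact absurd (honly i hi (Redex.overlap_of_mem hzi hzj)) hiu
      · simp only [D, hiu, hju, if_false] at hzi hzj
        exact hA i hi j hj (Redex.overlap_of_mem hzi hzj)
  rw [← hPU']
  refine Eval.exchange (P := P) hcl hdisj ?_ ?_ (hPU.symm ▸ hA) ?_ ?_ (hPU.symm ▸ h) ?_
  · rintro ⟨i, hi⟩ w rfl
    by_cases hwu : w = u
    · subst hwu
      simp [D]
    · simp [D, hwu]
  · rintro ⟨i, hi⟩ w rfl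
    exact hAm w hi
  · rintro ⟨i, hi⟩ w hw
    by_cases hwu : i = u
    · have : w = v := by simpa [P', hwu] using hw
      subst this
      simp [D, hwu, w.pos_mem_pattern]
    · have : w = i := by simpa [P', hwu] using hw
      subst this
      simp [D, hwu, w.pos_mem_pattern]
  · rintro ⟨i, hi⟩ q a h
    by_cases hwu : i = u
    · subst hwu
      have hcl := hcl ⟨i, hi⟩
      have hu1 : i.pattern ⊆ D ⟨i, hi⟩ := by simp [D]
      have hv1 : v.pattern ⊆ D ⟨i, hi⟩ := by simp [D]
      have hmu := hcl.matches_clusterTerm (hAm i hi) hu1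
      have hmv := hcl.matches_clusterTerm hvm hv1
      have hlu := hR.1 _ (hAR i hi)
      have hlv := hR.1 _ hvR
      obtain ⟨N, hN⟩ := hmu.exists_contr hlu
      obtain ⟨N', hN'⟩ := hmv.exists_contr hlv
      have hNN := hN.eq_of_overlap hR (hAR i hi) hvR hmu hmv hN' huv
      subst hNN
      have hP' : P' ⟨i, hi⟩ = {v} := by simp [P']
      rw [hP', eval_singleton hlv hmv hN' (hcl.root_prefix _ (hv1 v.pos_mem_pattern))]
      exact (eval_singleton hlu hmu hN (hcl.root_prefix _ (hu1 i.pos_mem_pattern))).1 h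
    · have hP' : P' ⟨i, hi⟩ = {i} := by simp [P', hwu]
      rw [hP']
      exact h
  · intro i hpi
    exact (hpc i).eq_of_length_le ((hcl i).root_prefix p hpi).length_le

/-! ### Orthogonalization along a path -/

/-- The pairs of different overlapping redexes from `A` and `B`. -/
def conflicts (A B : Set (Redex S V)) : Set (Redex S V × Redex S V) :=
  {x | x.1 ∈ A ∧ x.2 ∈ B ∧ x.1.Overlap x.2 ∧ x.1 ≠ x.2}

theorem finite_of_nonOverlapping {A : Set (Redex S V)} (hA : NonOverlapping A) {p : Pos}
    (hp : ∀ w ∈ A, w.pos <+: p) : A.Finite := by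
  refine Set.Finite.of_finite_image (f := Redex.pos) ?_ fun x hx y hy h =>
    hA x hx y hy (Redex.overlap_of_pos_eq h)
  refine (List.finite_toSet p.inits).subset ?_
  rintro _ ⟨w, hw, rfl⟩
  simpa using hp w hw

/-- For redexes along one path, a topmost redex `x` of `A` in conflict with `B` either overlaps a
single member of `B`, or it overlaps a member of `B` that overlaps no other member of `A`. In the
latter case this is the first of the members of `B` that overlap `x`: its pattern ends within that
of `x`, before the second one starts. -/
theorem exists_replaceable {A B : Set (Redex S V)} (hA : NonOverlapping A) (hB : NonOverlapping B)
    {p : Pos} (hpA : ∀ w ∈ A, w.pos <+: p) (hpB : ∀ w ∈ B, w.pos <+: p) {x : Redex S V}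
    (hx : x ∈ A) (hxB : ∃ y ∈ B, x.Overlap y ∧ x ≠ y)
    (htop : ∀ y ∈ B, x.Overlap y → x ≠ y → x.pos.length ≤ y.pos.length) :
    ∃ y ∈ B, x.Overlap y ∧ x ≠ y ∧
      ((∀ b ∈ B, b.Overlap x → b = y) ∨ ∀ a ∈ A, a.Overlap y → a = x) := by
  obtain ⟨y₀, hy₀, hov₀, hne₀⟩ := hxB
  have hxB : x ∉ B := fun h => hne₀ (hB x h y₀ hy₀ hov₀)
  have hne : ∀ y ∈ B, x ≠ y := by
    rintro y hy rfl
    exact hxB hy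
  have hpat : ∀ y ∈ B, x.Overlap y → y.pos ∈ x.pattern := by
    intro y hy hov
    rcases Redex.overlap_iff.1 hov with h | h
    · exact h
    · have h1 := (Redex.pos_prefix_of_mem_pattern h).eq_of_length_le (htop y hy hov (hne y hy))
      rw [h1]
      exact x.pos_mem_pattern
  obtain ⟨y, ⟨hy, hov⟩, hmin⟩ := WellFounded.has_min
    (measure fun r : Redex S V => r.pos.length).wf {y | y ∈ B ∧ x.Overlap y} ⟨y₀, hy₀, hov₀⟩
  refine ⟨y, hy, hov, hne y hy, ?_⟩
  by_contra hcon
  push Not at hcon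
  obtain ⟨⟨y₂, hy₂, hov₂, hne₂⟩, a, ha, hay, hax⟩ := hcon
  have hyy : y.pos <+: y₂.pos :=
    List.prefix_of_prefix_length_le (hpB y hy) (hpB y₂ hy₂) (not_lt.1 (hmin y₂ ⟨hy₂, hov₂.symm⟩))
  have hay' : a.pos ∈ y.pattern := by
    rcases Redex.overlap_iff.1 hay with h | h
    · exact absurd (hA a ha x hx (Redex.overlap_of_mem h (hpat y hy hov))) hax
    · exact h
  rcases List.prefix_or_prefix_of_prefix (hpA a ha) (hpB y₂ hy₂) with h | h
  · have h1 : a.pos ∈ x.pattern := by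
      refine Redex.mem_pattern_of_prefix (hpat y₂ hy₂ hov₂.symm) ?_ h
      exact (Redex.pos_prefix_of_mem_pattern (hpat y hy hov)).trans
        (Redex.pos_prefix_of_mem_pattern hay')
    exact hax (hA a ha x hx (Redex.overlap_of_mem a.pos_mem_pattern h1))
  · exact hne₂ (hB y₂ hy₂ y hy (Redex.overlap_of_mem y₂.pos_mem_pattern
      (Redex.mem_pattern_of_prefix hay' hyy h)))

theorem nonOverlapping_replace {A : Set (Redex S V)} (hA : NonOverlapping A) {u v : Redex S V}
    (honly : ∀ w ∈ A, w.Overlap v → w = u) : NonOverlapping (insert v (A \ {u})) := by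
  rintro x (rfl | ⟨hx, hxu⟩) y (rfl | ⟨hy, hyu⟩) h
  · rfl
  · exact absurd (honly y hy h.symm) hyu
  · exact absurd (honly x hx h) hxu
  · exact hA x hx y hy h

/-- Two sets of redexes along a path can be made orthogonal without losing evaluations. Each
replacement of a redex by one from the other set removes a conflict. -/
theorem exists_orthogonal_of_path {R : Set (Rule S V)} (hR : WeaklyOrthogonal R) {s : ITerm S W}
    {p p₀ : Pos} (A B : Set (Redex S V)) (hA : NonOverlapping A) (hB : NonOverlapping B)
    (hall : ∀ w ∈ A ∪ B, w.rule ∈ R ∧ w.Matches s ∧ w.pos <+: p ∧ p₀ <+: w.pos) :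
    ∃ A' B' : Set (Redex S V), A' ⊆ A ∪ B ∧ B' ⊆ A ∪ B ∧ NonOverlapping A' ∧ NonOverlapping B' ∧
      (∀ x ∈ A', ∀ y ∈ B', x.Overlap y → x = y) ∧
      (∀ q a, Eval s A p₀ q a → Eval s A' p₀ q a) ∧
      (∀ q a, Eval s B p₀ q a → Eval s B' p₀ q a) := by
  induction hn : (conflicts A B).ncard using Nat.strong_induction_on generalizing A B with
  | _ n ih =>
  subst hn
  have hpA : ∀ w ∈ A, w.pos <+: p := fun w hw => (hall w (Or.inl hw)).2.2.1
  have hpB : ∀ w ∈ B, w.pos <+: p := fun w hw => (hall w (Or.inr hw)).2.2.1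
  have hfin : (conflicts A B).Finite :=
    ((finite_of_nonOverlapping hA hpA).prod (finite_of_nonOverlapping hB hpB)).subset
      fun x hx => ⟨hx.1, hx.2.1⟩
  -- Replacement of `y` in `B` by a redex `x` of `A`.
  have hstepB : ∀ x ∈ A, ∀ y ∈ B, x.Overlap y → x ≠ y → (∀ b ∈ B, b.Overlap x → b = y) →
      ∃ A' B' : Set (Redex S V), A' ⊆ A ∪ B ∧ B' ⊆ A ∪ B ∧ NonOverlapping A' ∧
        NonOverlapping B' ∧ (∀ x ∈ A', ∀ y ∈ B', x.Overlap y → x = y) ∧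
        (∀ q a, Eval s A p₀ q a → Eval s A' p₀ q a) ∧
        (∀ q a, Eval s B p₀ q a → Eval s B' p₀ q a) := by
    intro x hx y hy hov hne honly
    have hsub : A ∪ insert x (B \ {y}) ⊆ A ∪ B := by
      rintro z (hz | rfl | ⟨hz, -⟩)
      · exact Or.inl hz
      · exact Or.inl hx
      · exact Or.inr hz
    have hlt : (conflicts A (insert x (B \ {y}))).ncard < (conflicts A B).ncard := by
      refine Set.ncard_lt_ncard ⟨?_, fun h => ?_⟩ hfin
      · rintro ⟨a, b⟩ ⟨ha, rfl | ⟨hb, -⟩, h1, h2⟩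
        · exact absurd (hA _ ha _ hx h1) h2
        · exact ⟨ha, hb, h1, h2⟩
      · rcases (h (show (x, y) ∈ conflicts A B from ⟨hx, hy, hov, hne⟩)).2.1 with h1 | ⟨-, h1⟩
        · exact hne h1.symm
        · exact h1 rfl
    obtain ⟨A', B', h1, h2, h3, h4, h5, h6, h7⟩ := ih _ hlt A (insert x (B \ {y})) hA
      (nonOverlapping_replace hB honly) (fun w hw => hall w (hsub hw)) rfl
    refine ⟨A', B', h1.trans hsub, h2.trans hsub, h3, h4, h5, h6, fun q a h => h7 q a ?_⟩
    obtain ⟨hxR, hxm, -, hxp⟩ := hall x (Or.inl hx)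
    exact h.replace hR hB (fun w hw => (hall w (Or.inr hw)).1) (fun w hw => (hall w (Or.inr hw)).2.1)
      hy hxR hxm hov.symm honly (fun w hw => (hall w (Or.inr hw)).2.2.2) hxp
  -- Replacement of `x` in `A` by a redex `y` of `B`.
  have hstepA : ∀ x ∈ A, ∀ y ∈ B, x.Overlap y → x ≠ y → (∀ a ∈ A, a.Overlap y → a = x) →
      ∃ A' B' : Set (Redex S V), A' ⊆ A ∪ B ∧ B' ⊆ A ∪ B ∧ NonOverlapping A' ∧
        NonOverlapping B' ∧ (∀ x ∈ A', ∀ y ∈ B', x.Overlap y → x = y) ∧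
        (∀ q a, Eval s A p₀ q a → Eval s A' p₀ q a) ∧
        (∀ q a, Eval s B p₀ q a → Eval s B' p₀ q a) := by
    intro x hx y hy hov hne honly
    have hsub : insert y (A \ {x}) ∪ B ⊆ A ∪ B := by
      rintro z ((rfl | ⟨hz, -⟩) | hz)
      · exact Or.inr hy
      · exact Or.inl hz
      · exact Or.inr hz
    have hlt : (conflicts (insert y (A \ {x})) B).ncard < (conflicts A B).ncard := by
      refine Set.ncard_lt_ncard ⟨?_, fun h => ?_⟩ hfin
      · rintro ⟨a, b⟩ ⟨rfl | ⟨ha, -⟩, hb, h1, h2⟩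
        · exact absurd (hB _ hy _ hb h1) h2
        · exact ⟨ha, hb, h1, h2⟩
      · rcases (h (show (x, y) ∈ conflicts A B from ⟨hx, hy, hov, hne⟩)).1 with h1 | ⟨-, h1⟩
        · exact hne h1
        · exact h1 rfl
    obtain ⟨A', B', h1, h2, h3, h4, h5, h6, h7⟩ := ih _ hlt (insert y (A \ {x})) B
      (nonOverlapping_replace hA honly) hB (fun w hw => hall w (hsub hw)) rfl
    refine ⟨A', B', h1.trans hsub, h2.trans hsub, h3, h4, h5, fun q a h => h6 q a ?_, h7⟩
    obtain ⟨hyR, hym, -, hyp⟩ := hall y (Or.inr hy)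
    exact h.replace hR hA (fun w hw => (hall w (Or.inl hw)).1) (fun w hw => (hall w (Or.inl hw)).2.1)
      hx hyR hym hov honly (fun w hw => (hall w (Or.inl hw)).2.2.2) hyp
  rcases (conflicts A B).eq_empty_or_nonempty with hem | ⟨⟨a₀, b₀⟩, h₀⟩
  · refine ⟨A, B, Set.subset_union_left, Set.subset_union_right, hA, hB, ?_, fun _ _ => id,
      fun _ _ => id⟩
    intro x hx y hy hov
    by_contra hne
    exact hem.subset (show (x, y) ∈ conflicts A B from ⟨hx, hy, hov, hne⟩)
  · obtain ⟨z, ⟨⟨a, b⟩, hab, hz⟩, hmin⟩ := WellFounded.has_min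
      (measure fun r : Redex S V => r.pos.length).wf
      {z | ∃ x ∈ conflicts A B, z = x.1 ∨ z = x.2} ⟨a₀, _, h₀, Or.inl rfl⟩
    obtain ⟨ha, hb, hov, hne⟩ := hab
    dsimp only at ha hb hov hne hz
    rcases hz with rfl | rfl
    · obtain ⟨y, hy, hov', hne', h | h⟩ := exists_replaceable hA hB hpA hpB ha ⟨b, hb, hov, hne⟩
        fun y hy h1 h2 => not_lt.1 (hmin y ⟨(z, y), ⟨ha, hy, h1, h2⟩, Or.inr rfl⟩)
      · exact hstepB z ha y hy hov' hne' h
      · exact hstepA z ha y hy hov' hne' h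
    · obtain ⟨y, hy, hov', hne', h | h⟩ := exists_replaceable hB hA hpB hpA hb
        ⟨a, ha, hov.symm, hne.symm⟩
        fun y hy h1 h2 => not_lt.1 (hmin y ⟨(y, z), ⟨hy, hb, h1.symm, h2.symm⟩, Or.inl rfl⟩)
      · exact hstepA y hy z hb hov'.symm hne'.symm h
      · exact hstepB y hy z hb hov'.symm hne'.symm h

/-! ### Connected components of overlapping redexes -/

/-- Two members of `E` are linked if they overlap. -/
def Linked (E : Set (Redex S V)) (x y : Redex S V) : Prop := x ∈ E ∧ y ∈ E ∧ x.Overlap y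

/-- The redexes that are connected to `w` by a chain of overlapping members of `E`. -/
def component (E : Set (Redex S V)) (w : Redex S V) : Set (Redex S V) :=
  {x | Relation.ReflTransGen (Linked E) w x}

theorem linked_symm (E : Set (Redex S V)) : Std.Symm (Linked E) :=
  ⟨fun _ _ h => ⟨h.2.1, h.1, h.2.2.symm⟩⟩

theorem mem_component_self (E : Set (Redex S V)) (w : Redex S V) : w ∈ component E w :=
  Relation.ReflTransGen.refl

theorem component_subset {E : Set (Redex S V)} {w : Redex S V} (hw : w ∈ E) :
    component E w ⊆ E := by
  intro x hx
  rcases Relation.ReflTransGen.cases_tail hx with h | ⟨y, -, h⟩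
  · exact h ▸ hw
  · exact h.2.1

theorem component_eq {E : Set (Redex S V)} {w x : Redex S V} (h : x ∈ component E w) :
    component E x = component E w := by
  have := linked_symm E
  have hx : Relation.ReflTransGen (Linked E) x w := Std.Symm.symm w x h
  ext y
  exact ⟨fun hy => Relation.ReflTransGen.trans h hy, fun hy => Relation.ReflTransGen.trans hx hy⟩

theorem component_eq_of_overlap {E : Set (Redex S V)} {w w' x y : Redex S V} (hw : w ∈ E)
    (hw' : w' ∈ E) (hx : x ∈ component E w) (hy : y ∈ component E w') (h : x.Overlap y) :
    component E w = component E w' := by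
  rw [← component_eq hx, ← component_eq hy]
  exact (component_eq (Relation.ReflTransGen.single
    ⟨component_subset hw hx, component_subset hw' hy, h⟩)).symm

/-- The positions covered by the patterns of a set of redexes. -/
def cover (K : Set (Redex S V)) : Set Pos := ⋃ x ∈ K, x.pattern

theorem mem_cover {K : Set (Redex S V)} {p : Pos} : p ∈ cover K ↔ ∃ x ∈ K, p ∈ x.pattern := by
  simp [cover]

theorem exists_isCluster_component {t : ITerm S W} {E : Set (Redex S V)}
    (hE : ∀ x ∈ E, x.Matches t) {w : Redex S V} (hw : w ∈ E) :
    ∃ c, IsCluster t c (cover (component E w)) := by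
  obtain ⟨x₀, hx₀, hmin⟩ := WellFounded.has_min (measure fun r : Redex S V => r.pos.length).wf
    (component E w) ⟨w, mem_component_self E w⟩
  have hmin : ∀ y ∈ component E w, x₀.pos.length ≤ y.pos.length :=
    fun y hy => not_lt.1 (hmin y hy)
  -- By induction along chains of overlapping redexes starting from a topmost one.
  have key : ∀ x ∈ component E w, x₀.pos <+: x.pos ∧
      ∀ k, x₀.pos <+: k → k <+: x.pos → k ∈ cover (component E w) := by
    intro x hx
    rw [← component_eq hx₀] at hx
    induction hx with
    | refl =>
      refine ⟨List.prefix_rfl, fun k h1 h2 => ?_⟩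
      rw [h2.eq_of_length_le h1.length_le]
      exact mem_cover.2 ⟨x₀, hx₀, x₀.pos_mem_pattern⟩
    | @tail y z hy hyz ih =>
      obtain ⟨ih1, ih2⟩ := ih
      have hyK : y ∈ component E w := component_eq hx₀ ▸ hy
      have hzK : z ∈ component E w := hyK.tail hyz
      obtain ⟨m, hmy, hmz⟩ := hyz.2.2
      have hym := Redex.pos_prefix_of_mem_pattern hmy
      have hzm := Redex.pos_prefix_of_mem_pattern hmz
      refine ⟨List.prefix_of_prefix_length_le (ih1.trans hym) hzm (hmin z hzK),
        fun k h1 h2 => ?_⟩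
      rcases List.prefix_or_prefix_of_prefix hym (h2.trans hzm) with h3 | h3
      · exact mem_cover.2 ⟨y, hyK, Redex.mem_pattern_of_prefix hmy h3 (h2.trans hzm)⟩
      · exact ih2 k h1 h3
  refine ⟨x₀.pos, mem_cover.2 ⟨x₀, hx₀, x₀.pos_mem_pattern⟩, ?_, ?_, ?_⟩
  · intro p hp
    obtain ⟨x, hx, hpx⟩ := mem_cover.1 hp
    exact (key x hx).1.trans (Redex.pos_prefix_of_mem_pattern hpx)
  · intro p hp k h1 h2
    obtain ⟨x, hx, hpx⟩ := mem_cover.1 hp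
    rcases List.prefix_or_prefix_of_prefix (Redex.pos_prefix_of_mem_pattern hpx) h2 with h3 | h3
    · exact mem_cover.2 ⟨x, hx, Redex.mem_pattern_of_prefix hpx h3 h2⟩
    · exact (key x hx).2 k h1 h3
  · intro p hp
    obtain ⟨x, hx, hpx⟩ := mem_cover.1 hp
    exact (hE x (component_subset hw hx)).exists_fun hpx

/-- If no single contraction of a member of `A` changes `s`, then neither does developing `A`. -/
theorem Eval.of_trivial {s : ITerm S W} {A : Set (Redex S V)} (hA : ∀ u ∈ A, Contr s u s)
    {p q : Pos} {a : S.Sym ⊕ W} (h : Eval s A p q a) : s.sym (p ++ q) = some a := by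
  induction h with
  | here hp ha => simpa using ha
  | down hp hf hi h ih => simpa using ih
  | emit u hu hp hf => exact hp ▸ (hA u hu).fn _ _ hf
  | @jump p q a u hu hp x o o' r ho ho' hq h ih =>
    subst hp hq
    rw [(hA u hu).arg x o o' r ho ho', ← List.append_assoc]
    exact ih

/-- Orthogonalization inside a component. All redexes of the component have the same contraction in
the truncated term. If it is trivial, all of them can be dropped. Otherwise all redexes lie above a
position where it changes the term, hence on one path. -/
theorem exists_orthogonal_of_component {R : Set (Rule S V)} (hR : WeaklyOrthogonal R)
    {t : ITerm S W} {U₁ U₂ : Set (Redex S V)} (hU₁ : NonOverlapping U₁) (hU₂ : NonOverlapping U₂)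
    (hER : ∀ x ∈ U₁ ∪ U₂, x.rule ∈ R) (hE : ∀ x ∈ U₁ ∪ U₂, x.Matches t) {w : Redex S V}
    (hw : w ∈ U₁ ∪ U₂) {c : Pos} {K : Set (Redex S V)} (hK : K = component (U₁ ∪ U₂) w)
    (hc : IsCluster t c (cover K)) :
    ∃ A' B' : Set (Redex S V), A' ⊆ K ∧ B' ⊆ K ∧ NonOverlapping A' ∧ NonOverlapping B' ∧
      (∀ x ∈ A', ∀ y ∈ B', x.Overlap y → x = y) ∧
      (∀ q a, Eval (clusterTerm t c (cover K)) (U₁ ∩ K) c q a →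
        Eval (clusterTerm t c (cover K)) A' c q a) ∧
      (∀ q a, Eval (clusterTerm t c (cover K)) (U₂ ∩ K) c q a →
        Eval (clusterTerm t c (cover K)) B' c q a) := by
  have hKE : K ⊆ U₁ ∪ U₂ := hK ▸ component_subset hw
  set s := clusterTerm t c (cover K)
  have hms : ∀ x ∈ K, x.Matches s := fun x hx =>
    hc.matches_clusterTerm (hE x (hKE hx)) fun p hp => mem_cover.2 ⟨x, hx, hp⟩
  have hwK : w ∈ K := hK ▸ mem_component_self _ w
  obtain ⟨N, hN⟩ := (hms w hwK).exists_contr (hR.1 _ (hER w hw))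
  have hall : ∀ x ∈ K, Contr s x N := by
    intro x hx
    have hx' := hx
    rw [hK] at hx'
    induction hx' with
    | refl => exact hN
    | @tail y z hy hyz ih =>
      have hyK : y ∈ K := hK ▸ hy
      obtain ⟨N', hN'⟩ := (hms z hx).exists_contr (hR.1 _ (hER z hyz.2.1))
      rwa [(ih hyK).eq_of_overlap hR (hER y hyz.1) (hER z hyz.2.1) (hms y hyK) (hms z hx) hN'
        hyz.2.2]
  by_cases htriv : N = s
  · subst htriv
    have hnil : NonOverlapping (∅ : Set (Redex S V)) := fun u hu => hu.elim
    refine ⟨∅, ∅, Set.empty_subset _, Set.empty_subset _, hnil, hnil, fun x hx => hx.elim, ?_, ?_⟩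
    · exact fun q a h => eval_empty.2 (Eval.of_trivial (fun u hu => hall u hu.2) h)
    · exact fun q a h => eval_empty.2 (Eval.of_trivial (fun u hu => hall u hu.2) h)
  · obtain ⟨p, hp⟩ : ∃ p, N.sym p ≠ s.sym p := by
      by_contra hcon
      push Not at hcon
      exact htriv (ITerm.ext (funext hcon))
    have hsub : U₁ ∩ K ∪ U₂ ∩ K ⊆ K := by
      rintro x (hx | hx) <;> exact hx.2
    obtain ⟨A', B', h1, h2, h3⟩ := exists_orthogonal_of_path hR (s := s) (p := p) (p₀ := c)
      (U₁ ∩ K) (U₂ ∩ K) (fun x hx y hy => hU₁ x hx.1 y hy.1) (fun x hx y hy => hU₂ x hx.1 y hy.1)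
      fun x hx => ⟨hER x (hKE (hsub hx)), hms x (hsub hx), by
        by_contra hxp
        exact hp ((hall x (hsub hx)).outside p hxp),
        hc.root_prefix _ (mem_cover.2 ⟨x, hsub hx, x.pos_mem_pattern⟩)⟩
    exact ⟨A', B', h1.trans hsub, h2.trans hsub, h3⟩

/-- Two nonoverlapping sets of redexes in a term can be made orthogonal to each other without
changing the results of their developments. -/
theorem exists_orthogonal {R : Set (Rule S V)} (hR : WeaklyOrthogonal R)
    {t : ITerm S V} {U₁ U₂ : Set (Redex S V)} (hU₁ : NonOverlapping U₁) (hU₂ : NonOverlapping U₂)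
    (hER : ∀ x ∈ U₁ ∪ U₂, x.rule ∈ R) (hE : ∀ x ∈ U₁ ∪ U₂, x.Matches t) :
    ∃ U₁' U₂' : Set (Redex S V), U₁' ⊆ U₁ ∪ U₂ ∧ U₂' ⊆ U₁ ∪ U₂ ∧ NonOverlapping U₁' ∧
      NonOverlapping U₂' ∧ (∀ x ∈ U₁', ∀ y ∈ U₂', x.Overlap y → x = y) ∧
      (∀ s, Dev t U₁ s → Dev t U₁' s) ∧ (∀ s, Dev t U₂ s → Dev t U₂' s) := by
  let ι := {K : Set (Redex S V) // ∃ w ∈ U₁ ∪ U₂, K = component (U₁ ∪ U₂) w}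
  have hcl : ∀ K : ι, ∃ c, IsCluster t c (cover K.1) := by
    rintro ⟨_, w, hw, rfl⟩
    exact exists_isCluster_component hE hw
  choose c hc using hcl
  have hloc : ∀ K : ι, ∃ A' B' : Set (Redex S V), A' ⊆ K.1 ∧ B' ⊆ K.1 ∧ NonOverlapping A' ∧
      NonOverlapping B' ∧ (∀ x ∈ A', ∀ y ∈ B', x.Overlap y → x = y) ∧
      (∀ q a, Eval (clusterTerm t (c K) (cover K.1)) (U₁ ∩ K.1) (c K) q a →
        Eval (clusterTerm t (c K) (cover K.1)) A' (c K) q a) ∧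
      (∀ q a, Eval (clusterTerm t (c K) (cover K.1)) (U₂ ∩ K.1) (c K) q a →
        Eval (clusterTerm t (c K) (cover K.1)) B' (c K) q a) := by
    intro K
    obtain ⟨w, hw, hK⟩ := K.2
    exact exists_orthogonal_of_component hR hU₁ hU₂ hER hE hw hK (hc K)
  choose A B hAK hBK hA hB hAB hevA hevB using hloc
  have hsub : ∀ K : ι, K.1 ⊆ U₁ ∪ U₂ := by
    rintro ⟨_, w, hw, rfl⟩
    exact component_subset hw
  have hsame : ∀ K L : ι, ∀ x ∈ K.1, ∀ y ∈ L.1, x.Overlap y → K = L := by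
    rintro ⟨_, w, hw, rfl⟩ ⟨_, w', hw', rfl⟩ x hx y hy h
    exact Subtype.ext (component_eq_of_overlap hw hw' hx hy h)
  have hdisj : ∀ K L : ι, ∀ p, p ∈ cover K.1 → p ∈ cover L.1 → K = L := by
    intro K L p hK hL
    obtain ⟨x, hx, hpx⟩ := mem_cover.1 hK
    obtain ⟨y, hy, hpy⟩ := mem_cover.1 hL
    exact hsame K L x hx y hy (Redex.overlap_of_mem hpx hpy)
  have hexch : ∀ (U₀ : Set (Redex S V)) (A : ι → Set (Redex S V)), U₀ ⊆ U₁ ∪ U₂ →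
      NonOverlapping U₀ → (∀ K, A K ⊆ K.1) →
      (∀ K q a, Eval (clusterTerm t (c K) (cover K.1)) (U₀ ∩ K.1) (c K) q a →
        Eval (clusterTerm t (c K) (cover K.1)) (A K) (c K) q a) →
      ∀ s, Dev t U₀ s → Dev t (⋃ K, A K) s := by
    intro U₀ A hU₀ hno hA hev s hs q a ha
    have hPU : (⋃ K : ι, U₀ ∩ K.1) = U₀ := by
      ext x
      simp only [Set.mem_iUnion, Set.mem_inter_iff]
      exact ⟨fun ⟨_, h, _⟩ => h, fun h => ⟨⟨_, x, hU₀ h, rfl⟩, h, mem_component_self _ x⟩⟩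
    refine Eval.exchange (P := fun K : ι => U₀ ∩ K.1) hc hdisj ?_ ?_ (hPU.symm ▸ hno) ?_ hev
      (hPU.symm ▸ hs q a ha) ?_
    · exact fun K u hu p hp => mem_cover.2 ⟨u, hu.2, hp⟩
    · exact fun K u hu => hE u (hU₀ hu.1)
    · exact fun K u hu => mem_cover.2 ⟨u, hA K hu, u.pos_mem_pattern⟩
    · exact fun K hK => (List.prefix_nil.1 ((hc K).root_prefix _ hK)).symm
  have hun : ∀ A : ι → Set (Redex S V), (∀ K, A K ⊆ K.1) → (∀ K, NonOverlapping (A K)) →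
      NonOverlapping (⋃ K, A K) := by
    intro A hA hno x hx y hy h
    obtain ⟨K, hK⟩ := Set.mem_iUnion.1 hx
    obtain ⟨L, hL⟩ := Set.mem_iUnion.1 hy
    obtain rfl := hsame K L x (hA K hK) y (hA L hL) h
    exact hno K x hK y hL h
  refine ⟨⋃ K, A K, ⋃ K, B K, Set.iUnion_subset fun K => (hAK K).trans (hsub K),
    Set.iUnion_subset fun K => (hBK K).trans (hsub K), hun A hAK hA, hun B hBK hB, ?_,
    hexch U₁ A Set.subset_union_left hU₁ hAK hevA, hexch U₂ B Set.subset_union_right hU₂ hBK hevB⟩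
  intro x hx y hy h
  obtain ⟨K, hK⟩ := Set.mem_iUnion.1 hx
  obtain ⟨L, hL⟩ := Set.mem_iUnion.1 hy
  obtain rfl := hsame K L x (hAK K hK) y (hBK L hL) h
  exact hAB K x hK y hL h

end WOTRS

open WOTRS in
theorem mainTheorem3 {S : Signature.{u}} {X : Type v} (R : Set (Rule S X))
    (hR : WeaklyOrthogonal R) (t : ITerm S X) (U V : Set (Redex S X))
    (σ : Development R t U) (δ : Development R t V) :
    ∃ (U' V' : Set (Redex S X)) (σ' : Development R t U') (δ' : Development R t V'),
      IsOrthogonalization σ δ σ' δ' := by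
  have hin : ∀ x ∈ U ∪ V, x.In R t := by
    rintro x (hx | hx)
    · exact σ.isRedex x hx
    · exact δ.isRedex x hx
  have hmat : ∀ x ∈ U ∪ V, x.Matches t := by
    intro x hx
    obtain ⟨-, θ, hθ⟩ := hin x hx
    exact matches_of_isSubtermAt hθ
  obtain ⟨U', V', hU', hV', hnU, hnV, horth, hdU, hdV⟩ := exists_orthogonal hR
    σ.nonOverlapping δ.nonOverlapping (fun x hx => (hin x hx).1) hmat
  obtain ⟨σ', hσ'⟩ := exists_development hR (fun x hx => hin x (hU' hx)) hnU
    (hdU _ (σ.dev_target hR)) (σ.step 0)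
  obtain ⟨δ', hδ'⟩ := exists_development hR (fun x hx => hin x (hV' hx)) hnV
    (hdV _ (δ.dev_target hR)) (δ.step 0)
  exact ⟨U', V', σ', δ', horth, hσ', hδ'⟩
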